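/- Let $\Sigma$ be a closed surface with a Euclidean metric with cone singularities: a finite set $P=\{p_1,\dots,p_n\}\subset\Sigma$, angles $\theta_i>0$, and a flat Riemannian metric $ds_0^2$ on $\Sigma^*=\Sigma\setminus P$ which on a punctured neighbourhood of each $p_i$ is isometric to a punctured disc with the metric $dr^2+(\theta_i/2\pi)^2r^2d\alpha^2$, where $p_i$ corresponds to $r=0$. Let $\omega$ be a smooth closed $1$-form on $\Sigma^*$, and equip $\Sigma^*\times\mathbb R$ with the flat Lorentzian metric $ds_\omega^2=ds_0^2-(\omega+dt)^2$. Let $f\colon\Sigma\to\mathbb R$ be a function that is smooth on $\Sigma^*$ and such that near each $p_i$ one has $\omega':=\omega-df=\frac{\sigma_i}{2\pi}d\alpha$ for some $\sigma_i\in\mathbb R$ (one may take $f=0$ if $\omega$ already has this form near the singular points). Let $M=\Sigma\times\mathbb R$, where the singular lines $\{p_i\}\times\mathbb R$ are attached to $\Sigma^*\times\mathbb R$ in such a way that $(x,t)\mapsto(x,t+f(x))$ is a homeomorphism of $M$ onto $\Sigma\times\mathbb R$ with the product topology. Geodesics are affinely parametrised, are defined on nonempty open intervals, and may pass through singularities,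 as follows. A geodesic of $\Sigma$ is a continuous path that satisfies the geodesic equation of $ds_0^2$ at all times where it is in $\Sigma^*$, has the same speed at all these times, and either meets $P$ at isolated times only or is constant at a point of $P$. A geodesic of $(M,ds_\omega^2)$ is a continuous path $g$ that satisfies the geodesic equation of $ds^2_\omega$ at all times where it is in $\Sigma^*\times\mathbb R$, for which $ds_\omega^2(\dot g,\dot g)$ and $ds_\omega^2(\dot g,\partial_t)$ have the same value at all these times, and which either meets the singular lines at isolated times only or is of the form $s\mapsto(p_i,a+bs)$. (Constant paths are allowed.) Then $(M,ds_\omega^2)$ is geodesically complete: every inextensible geodesic is defined on all of $\mathbb R$, and every geodesic is the restriction of a geodesic defined on $\mathbb R$. Moreover, a path $g=(c,T)$ on an open interval $I$ is a geodesic of $(M,ds^2_\omega)$ if and only if $c$ is a geodesic of $\Sigma$ and there is $\lambda\in\mathbb R$ such that the following holds for all $a,s\in I$. First, $u\mapsto\omega'(\dot c(u))$ is integrable between $a$ and $s$, and $$T(s)+f(c(s))=T(a)+f(c(a))+\lambda(s-a)-\int_a^s\omega'(\dot c(u))\,du .$$ Secondly, if $c$ does not meet $P$ between $a$ and $s$,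 then $u\mapsto\omega(\dot c(u))$ is integrable there and $$T(s)=T(a)+\lambda(s-a)-\int_a^s\omega(\dot c(u))\,du .$$ In particular, if $\omega=\frac{\sigma_i}{2\pi}d\alpha$ near each $p_i$ and $f=0$, the geodesics are exactly the paths $s\mapsto\big(c(s),\,t_0+\lambda (s-a)-\int_a^s\omega(\dot c(u))\,du\big)$ with $c$ a geodesic of $\Sigma$ and $t_0,\lambda\in\mathbb R$. -/

import Mathlib

open scoped Manifold ContDiff Topology
open Set

noncomputable section

/-- The Euclidean plane, the model space of surfaces. -/
abbrev Plane : Type := EuclideanSpace ℝ (Fin 2)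

/-- The angular form `dα` on the punctured plane, evaluated at the point `y` on the vector `v`. -/
def angularForm (y v : Plane) : ℝ := (y 0 * v 1 - y 1 * v 0) / ‖y‖ ^ 2

/-- The metric `dr² + (θ/2π)² r² dα²` on the punctured plane, at the point `y`, evaluated on the
vectors `v` and `w`: the Euclidean plane with one cone singularity of angle `θ`. -/
def coneMetric (θ : ℝ) (y v w : Plane) : ℝ :=
  (inner ℝ y v / ‖y‖) * (inner ℝ y w / ‖y‖)
    + (θ / (2 * Real.pi)) ^ 2 * ‖y‖ ^ 2 * angularForm y v * angularForm y w

section Surface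

variable {S : Type*} [TopologicalSpace S] [ChartedSpace Plane S]

/-- A field of bilinear forms on the tangent spaces of `S`. -/
abbrev BilinField (S : Type*) [TopologicalSpace S] [ChartedSpace Plane S] : Type _ :=
  ∀ x : S, TangentSpace 𝓘(ℝ, Plane) x →L[ℝ] TangentSpace 𝓘(ℝ, Plane) x →L[ℝ] ℝ

/-- A field of linear forms on the tangent spaces of `S`. -/
abbrev CovectorField (S : Type*) [TopologicalSpace S] [ChartedSpace Plane S] : Type _ :=
  ∀ x : S, TangentSpace 𝓘(ℝ, Plane) x →L[ℝ] ℝ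

/-- `φ` is a smooth chart of `S` whose domain avoids `P`. -/
def IsChartOff (P : Set S) (φ : OpenPartialHomeomorph S Plane) : Prop :=
  φ ∈ IsManifold.maximalAtlas 𝓘(ℝ, Plane) ∞ S ∧ φ.source ⊆ Pᶜ

/-- `φ` is a smooth chart of `S` off `P` that carries the metric `g` to the Euclidean metric. -/
def IsFlatChart (P : Set S) (g : BilinField S) (φ : OpenPartialHomeomorph S Plane) : Prop :=
  IsChartOff P φ ∧ ∀ x ∈ φ.source, ∀ v w : TangentSpace 𝓘(ℝ, Plane) x,
    g x v w = inner (E := Plane) ℝ (mfderiv 𝓘(ℝ, Plane) 𝓘(ℝ, Plane) φ x v)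
      (mfderiv 𝓘(ℝ, Plane) 𝓘(ℝ, Plane) φ x w)

/-- `Φ` is a homeomorphism of a neighbourhood of `p` onto the disc of radius `R` about `0`, with
`Φ p = 0`, whose restriction to the punctured neighbourhood is a diffeomorphism onto the punctured
disc that carries `g` to the cone metric of angle `θ`. -/
structure IsConeChart (P : Set S) (g : BilinField S) (p : S) (θ R : ℝ)
    (Φ : OpenPartialHomeomorph S Plane) : Prop where
  radius_pos : 0 < R
  mem_source : p ∈ Φ.source
  map_center : Φ p = 0
  target_eq : Φ.target = Metric.ball 0 R
  source_inter : Φ.source ∩ P = {p}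
  smooth : ContMDiffOn 𝓘(ℝ, Plane) 𝓘(ℝ, Plane) ∞ Φ (Φ.source \ {p})
  smooth_symm : ContMDiffOn 𝓘(ℝ, Plane) 𝓘(ℝ, Plane) ∞ Φ.symm (Φ.target \ {0})
  isometric : ∀ x ∈ Φ.source \ {p}, ∀ v w : TangentSpace 𝓘(ℝ, Plane) x,
    g x v w = coneMetric θ (Φ x) (mfderiv 𝓘(ℝ, Plane) 𝓘(ℝ, Plane) Φ x v)
      (mfderiv 𝓘(ℝ, Plane) 𝓘(ℝ, Plane) Φ x w)

variable (S) in
/-- A Euclidean metric with cone singularities on the surface `S`: finitely many singular points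
with positive cone angles, and a flat Riemannian metric on their complement, that is, a field of
bilinear forms which near every regular point is the pull-back of the Euclidean metric under a
smooth chart (so it is smooth, symmetric and positive definite there). The values of `angle` at
regular points and of `metric` at singular points are irrelevant. -/
structure ConeSurface where
  sing : Finset S
  angle : S → ℝ
  metric : BilinField S
  angle_pos : ∀ p ∈ sing, 0 < angle p
  flat : ∀ x ∉ sing, ∃ φ : OpenPartialHomeomorph S Plane,
    IsFlatChart (sing : Set S) metric φ ∧ x ∈ φ.source
  cone : ∀ p ∈ sing, ∃ (R : ℝ) (Φ : OpenPartialHomeomorph S Plane),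
    IsConeChart (sing : Set S) metric p (angle p) R Φ

/-- The expression of a linear-form field in the chart `φ`. -/
def covectorInChart (η : CovectorField S) (φ : OpenPartialHomeomorph S Plane) (y : Plane) :
    Plane →L[ℝ] ℝ :=
  (η (φ.symm y)).comp (mfderiv 𝓘(ℝ, Plane) 𝓘(ℝ, Plane) φ.symm y)

/-- `η` is a smooth closed `1`-form on the complement of `P`: in every smooth chart off `P` its
coefficients are smooth and `dη = 0`. -/
def IsClosedFormOff (P : Set S) (η : CovectorField S) : Prop :=
  ∀ φ : OpenPartialHomeomorph S Plane, IsChartOff P φ →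
    ContDiffOn ℝ ∞ (covectorInChart η φ) φ.target ∧
    ∀ y ∈ φ.target, ∀ v w : Plane,
      fderiv ℝ (covectorInChart η φ) y v w = fderiv ℝ (covectorInChart η φ) y w v

/-- The linear-form field `η - df`. -/
def gaugedForm (η : CovectorField S) (f : S → ℝ) : CovectorField S := fun x =>
  η x - (show TangentSpace 𝓘(ℝ, Plane) x →L[ℝ] ℝ from mfderiv 𝓘(ℝ, Plane) 𝓘(ℝ, ℝ) f x)

/-- The metric `ds₀² - (η + dt)²` on `T_x S × ℝ`, the tangent space of `S × ℝ` at any `(x, t)`. -/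
def stationaryMetric (g : BilinField S) (η : CovectorField S) (x : S)
    (V W : TangentSpace 𝓘(ℝ, Plane) x × ℝ) : ℝ :=
  g x V.1 W.1 - (η x V.1 + V.2) * (η x W.1 + W.2)

/-- The expression of the metric `g` in the chart `φ`. -/
def metricInChart (g : BilinField S) (φ : OpenPartialHomeomorph S Plane) (y v w : Plane) : ℝ :=
  g (φ.symm y) (mfderiv 𝓘(ℝ, Plane) 𝓘(ℝ, Plane) φ.symm y v)
    (mfderiv 𝓘(ℝ, Plane) 𝓘(ℝ, Plane) φ.symm y w)

/-- The expression of the metric `ds₀² - (η + dt)²` in the chart `φ × id` of `S × ℝ`. -/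
def stationaryMetricInChart (g : BilinField S) (η : CovectorField S)
    (φ : OpenPartialHomeomorph S Plane) (z V W : Plane × ℝ) : ℝ :=
  stationaryMetric g η (φ.symm z.1)
    (mfderiv 𝓘(ℝ, Plane) 𝓘(ℝ, Plane) φ.symm z.1 V.1, V.2)
    (mfderiv 𝓘(ℝ, Plane) 𝓘(ℝ, Plane) φ.symm z.1 W.1, W.2)

end Surface

/-- The geodesic equation at the parameter `s`, for a curve `γ` and a pseudo-Riemannian metric `G`
on an open subset of a vector space, with lowered index:
`d/ds G_γ(γ', w) = ½ (∂_w G)_γ(γ', γ')` for all constant vectors `w`. -/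
def SolvesGeodesicEq {F : Type*} [NormedAddCommGroup F] [NormedSpace ℝ F]
    (G : F → F → F → ℝ) (γ : ℝ → F) (s : ℝ) : Prop :=
  ∃ V : ℝ → F, (∀ᶠ u in 𝓝 s, HasDerivAt γ (V u) u) ∧
    ∀ w : F, HasDerivAt (fun u => G (γ u) (V u) w)
      (1 / 2 * fderiv ℝ (fun y => G y (V s) (V s)) (γ s) w) s

/-- A nonempty open interval of the real line, possibly unbounded. -/
def IsOpenInterval (I : Set ℝ) : Prop := IsOpen I ∧ I.OrdConnected ∧ I.Nonempty

namespace ConeSurface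

variable {S : Type*} [TopologicalSpace S] [ChartedSpace Plane S] (X : ConeSurface S)

/-- The velocity vector of a path in `S`. -/
def velocity (c : ℝ → S) (s : ℝ) : TangentSpace 𝓘(ℝ, Plane) (c s) :=
  mfderiv 𝓘(ℝ, ℝ) 𝓘(ℝ, Plane) c s (1 : ℝ)

/-- `η` is a smooth closed `1`-form on the regular part of `S`. -/
def IsClosedForm (η : CovectorField S) : Prop := IsClosedFormOff (X.sing : Set S) η

/-- `f` is smooth on the regular part and `η - df = (σ_p / 2π) dα` near each singular point `p`,
where `α` is the angular coordinate of a cone chart at `p`. -/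
def IsGauge (η : CovectorField S) (f : S → ℝ) : Prop :=
  ContMDiffOn 𝓘(ℝ, Plane) 𝓘(ℝ, ℝ) ∞ f (X.sing : Set S)ᶜ ∧
  ∀ p ∈ X.sing, ∃ (σ R : ℝ) (Φ : OpenPartialHomeomorph S Plane),
    IsConeChart (X.sing : Set S) X.metric p (X.angle p) R Φ ∧
    ∀ x ∈ Φ.source \ {p}, ∀ v : TangentSpace 𝓘(ℝ, Plane) x,
      gaugedForm η f x v =
        σ / (2 * Real.pi) * angularForm (Φ x) (mfderiv 𝓘(ℝ, Plane) 𝓘(ℝ, Plane) Φ x v)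

/-- The path `c` is a geodesic of the cone surface on `I`, affinely parametrised and allowed to
pass through cone points: it is continuous, solves the geodesic equation at regular points, has the
same speed at all regular points, and either meets the cone points at isolated times only or is
constant at a cone point. -/
structure IsSurfaceGeodesic (c : ℝ → S) (I : Set ℝ) : Prop where
  continuousOn : ContinuousOn c I
  geodesic : ∀ s ∈ I, c s ∉ X.sing → ∃ φ : OpenPartialHomeomorph S Plane,
    IsFlatChart (X.sing : Set S) X.metric φ ∧ c s ∈ φ.source ∧
    SolvesGeodesicEq (metricInChart X.metric φ) (fun u => φ (c u)) s
  speed : ∃ q : ℝ, ∀ s ∈ I, c s ∉ X.sing → X.metric (c s) (velocity c s) (velocity c s) = q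
  crossing : (∀ s ∈ I, c s ∈ X.sing → ∀ᶠ u in 𝓝[≠] s, c u ∉ X.sing) ∨
    ∃ p ∈ X.sing, ∀ s ∈ I, c s = p

/-- The coordinate `t + f(x)` along a path `s ↦ (x, t)`. The singular lines are attached to the
regular part of `S × ℝ` so that `(x, t) ↦ (x, t + f x)` is a homeomorphism onto `S × ℝ` with the
product topology. -/
def height (f : S → ℝ) (γ : ℝ → S × ℝ) (s : ℝ) : ℝ := (γ s).2 + f (γ s).1

/-- The path `γ` is a geodesic on `I` of the singular spacetime with underlying set `S × ℝ` and
metric `ds₀² - (η + dt)²`, affinely parametrised and allowed to pass through singular lines: it is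
continuous, solves the geodesic equation at regular points, the conserved quantities given by
its squared norm and by the Killing field `∂_t` do not change when it crosses a singular line, and
either it meets the singular lines at isolated times only or it runs affinely in one of them. -/
structure IsSpacetimeGeodesic (η : CovectorField S) (f : S → ℝ) (γ : ℝ → S × ℝ) (I : Set ℝ) :
    Prop where
  continuousOn_fst : ContinuousOn (fun s => (γ s).1) I
  continuousOn_height : ContinuousOn (height f γ) I
  geodesic : ∀ s ∈ I, (γ s).1 ∉ X.sing → ∃ φ : OpenPartialHomeomorph S Plane,
    IsFlatChart (X.sing : Set S) X.metric φ ∧ (γ s).1 ∈ φ.source ∧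
    SolvesGeodesicEq (stationaryMetricInChart X.metric η φ)
      (fun u => ((φ (γ u).1, (γ u).2) : Plane × ℝ)) s
  conserved : ∃ q E : ℝ, ∀ s ∈ I, (γ s).1 ∉ X.sing →
    stationaryMetric X.metric η (γ s).1
      (velocity (fun u => (γ u).1) s, deriv (fun u => (γ u).2) s)
      (velocity (fun u => (γ u).1) s, deriv (fun u => (γ u).2) s) = q ∧
    stationaryMetric X.metric η (γ s).1
      (velocity (fun u => (γ u).1) s, deriv (fun u => (γ u).2) s) (0, 1) = E
  crossing : (∀ s ∈ I, (γ s).1 ∈ X.sing → ∀ᶠ u in 𝓝[≠] s, (γ u).1 ∉ X.sing) ∨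
    ∃ p ∈ X.sing, ∃ a b : ℝ, ∀ s ∈ I, γ s = (p, a + b * s)

/-- The geodesic `γ` on `I` is inextensible: it is not the restriction of a geodesic on a strictly
larger open interval. -/
def IsInextensible (η : CovectorField S) (f : S → ℝ) (γ : ℝ → S × ℝ) (I : Set ℝ) : Prop :=
  ¬ ∃ (J : Set ℝ) (γ' : ℝ → S × ℝ), IsOpenInterval J ∧ I ⊂ J ∧
    X.IsSpacetimeGeodesic η f γ' J ∧ EqOn γ' γ I

/-- Inextensible geodesics are defined on the entire real line. -/
def GeodesicallyComplete (η : CovectorField S) (f : S → ℝ) : Prop :=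
  ∀ (I : Set ℝ) (γ : ℝ → S × ℝ), IsOpenInterval I → X.IsSpacetimeGeodesic η f γ I →
    X.IsInextensible η f γ I → I = univ

end ConeSurface

end

/-! ### Isometries between flat pieces are affine -/

noncomputable section

/-! In a flat chart the base metric has constant coefficients, so `stationaryMetric` depends on
position only through the closed form $\omega$. Testing the geodesic equation on $\partial_t$ shows
that $\omega(\dot c)+\dot T$ is constant. In the other directions the only force term is this
constant times $d\omega$, which is zero. Off the singular lines a spacetime geodesic is therefore a
straight path $c$ together with $\dot T=\lambda-\omega(\dot c)$ (`isSpacetimeGeodesic_iff`). The two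
conserved quantities determine $\lambda$ and the speed of $c$, so neither changes across a singular
line.

What remains is the behaviour at cone points. Multiplying angles by $\theta/2\pi$ develops a
punctured cone locally into $\mathbb C$ isometrically, and there a geodesic becomes a segment
$A+tW$. Hence the squared distance to the tip is a quadratic polynomial in time with leading
coefficient $q$, the squared speed, and the angular momentum $J$ is constant with $J^2\le q\,r^2$. A
geodesic that reaches the tip has $J=0$, so it is radial and $d\alpha$ vanishes along it. Since
$\omega'=\frac{\sigma}{2\pi}d\alpha$ near the tip, $\omega'(\dot c)$ is zero close to each singular
time (`gaugedForm_velocity_eventually`). It therefore agrees off a countable set with a continuous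
function, $T+f$ has a primitive formula across the singular times, and that formula in turn recovers
the differential equation.

For completeness, compactness of the surface leaves two cases at a finite end of a geodesic. Either
there is a regular cluster point, and the path continues as a line in a flat chart, or the path
converges to a cone point, and it continues along any ray from the tip. In the second case the
quadratic for $r^2$ shows that the tip is not met again shortly before the end, so singular times
stay isolated. Zorn's lemma then extends $c$ to all of $\mathbb R$, and integrating $\omega'(\dot
c)$ lifts the extension to the spacetime. -/

theorem eventually_affine_of_isometric {E F : Type*} [NormedAddCommGroup E]
    [InnerProductSpace ℝ E] [NormedAddCommGroup F] [InnerProductSpace ℝ F]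
    [FiniteDimensional ℝ E] [FiniteDimensional ℝ F]
    (hdim : Module.finrank ℝ E = Module.finrank ℝ F) {h : E → F} {y₀ : E}
    (hs : ContDiffAt ℝ 2 h y₀)
    (hiso : ∀ᶠ y in 𝓝 y₀, ∀ v w, inner ℝ (fderiv ℝ h y v) (fderiv ℝ h y w) = inner ℝ v w) :
    ∃ L : E ≃ₗᵢ[ℝ] F, ∀ᶠ y in 𝓝 y₀, h y = h y₀ + L (y - y₀) := by
  have hsurj : ∀ y, (∀ v w, inner ℝ (fderiv ℝ h y v) (fderiv ℝ h y w) = inner ℝ v w) →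
      ∃ L : E ≃ₗᵢ[ℝ] F, ∀ v, L v = fderiv ℝ h y v := by
    intro y hy
    let l : E →ₗᵢ[ℝ] F := LinearMap.isometryOfInner (fderiv ℝ h y).toLinearMap hy
    exact ⟨LinearIsometry.toLinearIsometryEquiv l hdim, fun v => rfl⟩
  have hD2 : ∀ᶠ y in 𝓝 y₀, fderiv ℝ (fderiv ℝ h) y = 0 := by
    filter_upwards [hiso.eventually_nhds, hs.eventually (by simp)] with y hy hsy
    have hd : DifferentiableAt ℝ (fderiv ℝ h) y :=
      (hsy.fderiv_right (m := 1) (by norm_num)).differentiableAt (by norm_num)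
    have hsymm : IsSymmSndFDerivAt ℝ h y := hsy.isSymmSndFDerivAt (by simp)
    set D := fderiv ℝ (fderiv ℝ h) y with hDdef
    -- Differentiating the isometry relation makes $\langle D^2h(u,v),Dh\,w\rangle$ antisymmetric in
    -- $v,w$. It is symmetric in $u,v$, and a trilinear form with both symmetries is zero.
    have hanti : ∀ u v w, inner ℝ (fderiv ℝ h y v) (D u w) + inner ℝ (D u v) (fderiv ℝ h y w) = 0 := by
      intro u v w
      have hv : ∀ v, HasFDerivAt (fun z => fderiv ℝ h z v) (D.flip v) y := fun v => by
        have := hd.hasFDerivAt.clm_apply (hasFDerivAt_const v y)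
        simpa using this
      have h1 := (hv v).inner ℝ (hv w)
      have h2 : HasFDerivAt (fun z => inner ℝ (fderiv ℝ h z v) (fderiv ℝ h z w)) (0 : E →L[ℝ] ℝ) y :=
        (hasFDerivAt_const (inner ℝ v w : ℝ) y).congr_of_eventuallyEq (by
          filter_upwards [hy] with z hz using hz v w)
      have h3 := congrArg (fun T : E →L[ℝ] ℝ => T u) (h1.unique h2)
      simpa using h3
    obtain ⟨L, hL⟩ := hsurj y hy.self_of_nhds
    ext u v
    apply ext_inner_right ℝ
    intro w'
    obtain ⟨w, rfl⟩ := L.surjective w'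
    rw [hL w]
    have e1 := hanti u v w
    have e2 := hanti v w u
    have e3 := hanti w u v
    have s1 : D u v = D v u := hsymm u v
    have s2 : D v w = D w v := hsymm v w
    have s3 : D w u = D u w := hsymm w u
    rw [s2] at e2
    rw [s3] at e3
    have c1 := real_inner_comm (fderiv ℝ h y v) (D u w)
    have c2 := real_inner_comm (fderiv ℝ h y w) (D v u)
    have c3 := real_inner_comm (fderiv ℝ h y u) (D w v)
    rw [zero_apply, zero_apply, inner_zero_left]
    rw [s1] at e1 ⊢
    linarith
  obtain ⟨ε, hε, hball⟩ := Metric.eventually_nhds_iff_ball.1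
    (hD2.and ((hs.eventually (by simp)).and hiso))
  obtain ⟨L, hL⟩ := hsurj y₀ hiso.self_of_nhds
  refine ⟨L, ?_⟩
  have hpre : IsPreconnected (Metric.ball y₀ ε) := (convex_ball y₀ ε).isPreconnected
  have hy₀ : y₀ ∈ Metric.ball y₀ ε := Metric.mem_ball_self hε
  have hdd : ∀ y ∈ Metric.ball y₀ ε, fderiv ℝ h y = fderiv ℝ h y₀ := fun y hy =>
    Metric.isOpen_ball.is_const_of_fderiv_eq_zero (𝕜 := ℝ) hpre (f := fderiv ℝ h)
      (fun z hz => (((hball z hz).2.1.fderiv_right (m := 1) (by norm_num)).differentiableAt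
        (by norm_num)).differentiableWithinAt) (fun z hz => (hball z hz).1) hy hy₀
  filter_upwards [Metric.ball_mem_nhds y₀ hε] with y hy
  have hdiff : ∀ z ∈ Metric.ball y₀ ε, HasFDerivAt (fun z => h z - fderiv ℝ h y₀ z) (0 : E →L[ℝ] F) z := by
    intro z hz
    have hz' : DifferentiableAt ℝ h z := (hball z hz).2.1.differentiableAt (by norm_num)
    have := hz'.hasFDerivAt.sub (fderiv ℝ h y₀).hasFDerivAt
    rw [hdd z hz, sub_self] at this
    exact this
  have := Metric.isOpen_ball.is_const_of_fderiv_eq_zero (𝕜 := ℝ) hpre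
    (fun z hz => (hdiff z hz).differentiableAt.differentiableWithinAt)
    (fun z hz => (hdiff z hz).fderiv) hy hy₀
  rw [hL, map_sub]
  rw [← add_sub_assoc, add_sub_right_comm, ← this]
  abel

/-! ### The developing map of a cone -/

/-- The identification of the Euclidean plane with the complex numbers. -/
def planeToComplex : Plane ≃ₗᵢ[ℝ] ℂ := Complex.orthonormalBasisOneI.repr.symm

theorem planeToComplex_apply (y : Plane) : planeToComplex y = y 0 + y 1 * Complex.I := by
  have h := Complex.orthonormalBasisOneI.sum_repr_symm y
  rw [planeToComplex, ← h]
  simp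

/-- The real linear map `a + i b ↦ a + i κ b`. -/
def stretchIm (κ : ℝ) : ℂ →L[ℝ] ℂ :=
  Complex.ofRealCLM.comp Complex.reCLM
    + ((κ : ℂ) * Complex.I) • Complex.ofRealCLM.comp Complex.imCLM

theorem stretchIm_apply (κ : ℝ) (z : ℂ) : stretchIm κ z = ⟨z.re, κ * z.im⟩ := by
  apply Complex.ext <;> simp [stretchIm]

/-- The developing map of the cone of angle `2πκ` near the point `y₀` of the punctured plane: in
polar coordinates centred at the direction of `y₀` it multiplies angles by `κ`. -/
def develop (κ : ℝ) (y₀ y : Plane) : ℂ :=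
  ‖y₀‖ * Complex.exp (stretchIm κ (Complex.log (planeToComplex y / planeToComplex y₀)))

theorem eventually_div_mem_slitPlane {y₀ : Plane} (h₀ : y₀ ≠ 0) :
    ∀ᶠ y in 𝓝 y₀, planeToComplex y / planeToComplex y₀ ∈ Complex.slitPlane := by
  have h : ContinuousAt (fun y => planeToComplex y / planeToComplex y₀) y₀ := by fun_prop
  apply h.eventually_mem
  refine Complex.isOpen_slitPlane.mem_nhds ?_
  simp [h₀]

/-- `stretchIm` leaves the real part of the logarithm alone, so only the argument is changed. -/
theorem norm_develop {κ : ℝ} {y₀ y : Plane} (h₀ : y₀ ≠ 0) (hy : y ≠ 0) :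
    ‖develop κ y₀ y‖ = ‖y‖ := by
  have hz : planeToComplex y / planeToComplex y₀ ≠ 0 := by simp [h₀, hy]
  have h₀' : ‖y₀‖ ≠ 0 := norm_ne_zero_iff.2 h₀
  rw [develop, norm_mul, Complex.norm_exp, stretchIm_apply, Complex.log_re, Real.exp_log
    (norm_pos_iff.2 hz)]
  simp
  field_simp

/-- On the ray through the base point the logarithm is real, so the ray develops onto the positive
real axis. -/
theorem develop_smul {κ : ℝ} {y₀ : Plane} (h₀ : y₀ ≠ 0) {t : ℝ} (ht : 0 < t) :
    develop κ y₀ (t • y₀) = (t * ‖y₀‖ : ℝ) := by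
  have : planeToComplex (t • y₀) / planeToComplex y₀ = (t : ℂ) := by
    rw [map_smul, Complex.real_smul, mul_div_assoc, div_self (by simpa using h₀), mul_one]
  rw [develop, this, ← Complex.ofReal_log ht.le, stretchIm_apply]
  have : (⟨((Real.log t : ℝ) : ℂ).re, κ * ((Real.log t : ℝ) : ℂ).im⟩ : ℂ) = (Real.log t : ℝ) := by
    apply Complex.ext <;> simp
  rw [this, ← Complex.ofReal_exp, Real.exp_log ht]
  push_cast; ring

theorem contDiffAt_develop (κ : ℝ) {y₀ y : Plane}
    (hy : planeToComplex y / planeToComplex y₀ ∈ Complex.slitPlane) :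
    ContDiffAt ℝ ∞ (develop κ y₀) y := by
  have h1 : ContDiffAt ℝ ∞ (fun y => planeToComplex y / planeToComplex y₀) y :=
    (planeToComplex.contDiff.contDiffAt).div_const _
  have h2 : ContDiffAt ℝ ∞ Complex.log (planeToComplex y / planeToComplex y₀) :=
    (Complex.contDiffAt_log hy).restrict_scalars ℝ
  have h3 := h2.comp y h1
  have h4 := ((stretchIm κ).contDiff.contDiffAt.comp y h3).cexp
  exact contDiffAt_const.mul h4

/-- This is $dz/z=dr/r+i\,d\alpha$. -/
theorem planeToComplex_div (y v : Plane) (hy : y ≠ 0) :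
    planeToComplex v / planeToComplex y = ⟨inner ℝ y v / ‖y‖ ^ 2, angularForm y v⟩ := by
  have hn : ‖y‖ ^ 2 = y 0 ^ 2 + y 1 ^ 2 := by
    rw [EuclideanSpace.norm_sq_eq]; simp
  have hpos : y 0 ^ 2 + y 1 ^ 2 ≠ 0 := by
    rw [← hn]; simpa using hy
  have hne : planeToComplex y ≠ 0 := by simpa using hy
  rw [div_eq_iff hne, planeToComplex_apply, planeToComplex_apply, angularForm, hn]
  have hi : inner ℝ y v = y 0 * v 0 + y 1 * v 1 := by
    simp [PiLp.inner_apply, mul_comm]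
  rw [hi]
  apply Complex.ext <;> simp <;> field_simp <;> ring

theorem fderiv_develop_apply (κ : ℝ) {y₀ y : Plane} (h₀ : y₀ ≠ 0) (hy0 : y ≠ 0)
    (hy : planeToComplex y / planeToComplex y₀ ∈ Complex.slitPlane) (v : Plane) :
    fderiv ℝ (develop κ y₀) y v =
      develop κ y₀ y * ⟨inner ℝ y v / ‖y‖ ^ 2, κ * angularForm y v⟩ := by
  have h1 : HasFDerivAt (fun y => planeToComplex y / planeToComplex y₀)
      ((planeToComplex y₀)⁻¹ • (planeToComplex.toContinuousLinearEquiv : Plane →L[ℝ] ℂ)) y := by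
    have := (planeToComplex.toContinuousLinearEquiv : Plane →L[ℝ] ℂ).hasFDerivAt (x := y)
    simp only [div_eq_mul_inv]
    exact this.mul_const _
  have h2 : HasFDerivAt Complex.log _ (planeToComplex y / planeToComplex y₀) :=
    ((Complex.hasStrictDerivAt_log hy).hasDerivAt.hasFDerivAt).restrictScalars ℝ
  have h3 := ((stretchIm κ).hasFDerivAt.comp y (h2.comp y h1)).cexp.const_mul (‖y₀‖ : ℂ)
  have h4 := congrArg (fun T : Plane →L[ℝ] ℂ => T v) h3.fderiv
  have e : fderiv ℝ (develop κ y₀) y v = _ := h4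
  rw [e]
  have hne : planeToComplex y ≠ 0 := by simpa using hy0
  have hne0 : planeToComplex y₀ ≠ 0 := by simpa using h₀
  have key : (planeToComplex y₀)⁻¹ * planeToComplex v * (planeToComplex y / planeToComplex y₀)⁻¹
      = planeToComplex v / planeToComplex y := by field_simp
  have key2 : (⟨inner ℝ y v / ‖y‖ ^ 2, κ * angularForm y v⟩ : ℂ)
      = stretchIm κ (planeToComplex v / planeToComplex y) := by
    rw [planeToComplex_div y v hy0, stretchIm_apply]
  rw [key2, ← key, develop]
  simp [mul_assoc]

/-- With $\kappa=\theta/2\pi$ the developing map $k$ satisfies $dk/k=dr/r+i\kappa\,d\alpha$ and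
$|k|=r$, so the pull-back of the Euclidean metric is $dr^2+\kappa^2r^2d\alpha^2$. -/
theorem inner_fderiv_develop (θ : ℝ) {y₀ y : Plane} (h₀ : y₀ ≠ 0) (hy0 : y ≠ 0)
    (hy : planeToComplex y / planeToComplex y₀ ∈ Complex.slitPlane) (v w : Plane) :
    inner ℝ (fderiv ℝ (develop (θ / (2 * Real.pi)) y₀) y v)
      (fderiv ℝ (develop (θ / (2 * Real.pi)) y₀) y w) = coneMetric θ y v w := by
  have hn := norm_develop (κ := θ / (2 * Real.pi)) h₀ hy0
  rw [fderiv_develop_apply _ h₀ hy0 hy, fderiv_develop_apply _ h₀ hy0 hy]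
  set d := develop (θ / (2 * Real.pi)) y₀ y
  have hd : d.re * d.re + d.im * d.im = ‖y‖ ^ 2 := by
    rw [← hn, ← Complex.normSq_apply, Complex.normSq_eq_norm_sq]
  have hyn : ‖y‖ ≠ 0 := norm_ne_zero_iff.2 hy0
  rw [Complex.inner, coneMetric]
  simp only [map_mul, Complex.mul_re, Complex.conj_re, Complex.conj_im, Complex.mul_im]
  have : ∀ a b c e : ℝ, (d.re * c - d.im * e) * (d.re * a - -d.im * -b)
      - (d.re * e + d.im * c) * (d.re * -b + -d.im * a)
      = (d.re * d.re + d.im * d.im) * (a * c + b * e) := by intros; ring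
  rw [this, hd]
  field_simp

/-- Identifies the cone's angular momentum $\kappa r^2\dot\alpha$ with the Euclidean one of the
developed path. -/
theorem im_conj_develop_mul (κ : ℝ) {y₀ y : Plane} (h₀ : y₀ ≠ 0) (hy0 : y ≠ 0)
    (hy : planeToComplex y / planeToComplex y₀ ∈ Complex.slitPlane) (v : Plane) :
    ((starRingEnd ℂ) (develop κ y₀ y) * fderiv ℝ (develop κ y₀) y v).im =
      κ * ‖y‖ ^ 2 * angularForm y v := by
  have hn := norm_develop (κ := κ) h₀ hy0
  rw [fderiv_develop_apply _ h₀ hy0 hy, ← mul_assoc, mul_comm ((starRingEnd ℂ) _),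
    Complex.mul_conj, Complex.normSq_eq_norm_sq, hn, Complex.im_ofReal_mul]
  ring

/-! ### Flat charts and developed cone charts as local isometries -/

section LocalIsometry

variable {S : Type*} [TopologicalSpace S] [ChartedSpace Plane S]

theorem IsChartOff.mdifferentiable [IsManifold 𝓘(ℝ, Plane) ∞ S] {P : Set S}
    {φ : OpenPartialHomeomorph S Plane} (h : IsChartOff P φ) :
    φ.MDifferentiable 𝓘(ℝ, Plane) 𝓘(ℝ, Plane) :=
  ⟨(contMDiffOn_of_mem_maximalAtlas h.1).mdifferentiableOn (by simp),
    (contMDiffOn_symm_of_mem_maximalAtlas h.1).mdifferentiableOn (by simp)⟩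

theorem IsFlatChart.metricInChart_eq [IsManifold 𝓘(ℝ, Plane) ∞ S] {P : Set S} {g : BilinField S}
    {φ : OpenPartialHomeomorph S Plane} (h : IsFlatChart P g φ) {y : Plane} (hy : y ∈ φ.target)
    (v w : Plane) : metricInChart g φ y v w = inner ℝ v w := by
  have hc : ∀ v : Plane, mfderiv 𝓘(ℝ, Plane) 𝓘(ℝ, Plane) φ (φ.symm y)
      (mfderiv 𝓘(ℝ, Plane) 𝓘(ℝ, Plane) φ.symm y v) = v := fun v =>
    congrArg (fun T : Plane →L[ℝ] Plane => T v) (h.1.mdifferentiable.comp_symm_deriv hy)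
  rw [metricInChart, h.2 _ (φ.map_target hy)]
  exact congrArg₂ (fun a b : Plane => inner ℝ a b) (hc v) (hc w)

/-- The map `k` is smooth at `x` and carries `g` to the inner product near `x`. -/
def IsFlatMapAt {F : Type*} [NormedAddCommGroup F] [InnerProductSpace ℝ F]
    (g : BilinField S) (k : S → F) (x : S) : Prop :=
  ContMDiffAt 𝓘(ℝ, Plane) 𝓘(ℝ, F) ∞ k x ∧
    ∀ᶠ x' in 𝓝 x, ∀ v w : TangentSpace 𝓘(ℝ, Plane) x',
      g x' v w = inner (E := F) ℝ (mfderiv 𝓘(ℝ, Plane) 𝓘(ℝ, F) k x' v)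
        (mfderiv 𝓘(ℝ, Plane) 𝓘(ℝ, F) k x' w)

theorem IsFlatChart.isFlatMapAt [IsManifold 𝓘(ℝ, Plane) ∞ S] {P : Set S} {g : BilinField S}
    {φ : OpenPartialHomeomorph S Plane} (h : IsFlatChart P g φ) {x : S} (hx : x ∈ φ.source) :
    IsFlatMapAt g φ x :=
  ⟨contMDiffAt_of_mem_maximalAtlas h.1.1 hx,
    Filter.eventually_of_mem (φ.open_source.mem_nhds hx) h.2⟩

/-- Read in the chart `φ`, the map `k` is an isometry between Euclidean planes, hence affine.
Straightness can thus be tested in any flat map, in particular in a developed cone chart. -/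
theorem IsFlatMapAt.eventually_affine [IsManifold 𝓘(ℝ, Plane) ∞ S]
    {F : Type*} [NormedAddCommGroup F] [InnerProductSpace ℝ F] [FiniteDimensional ℝ F]
    (hF : Module.finrank ℝ F = 2) {P : Set S} {g : BilinField S}
    {φ : OpenPartialHomeomorph S Plane} (h : IsFlatChart P g φ) {x : S} (hx : x ∈ φ.source)
    {k : S → F} (hk : IsFlatMapAt g k x) :
    ∃ L : Plane ≃ₗᵢ[ℝ] F, ∀ᶠ x' in 𝓝 x, k x' = k x + L (φ x' - φ x) := by
  have hsx : φ.symm (φ x) = x := φ.left_inv hx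
  have hφx : φ x ∈ φ.target := φ.map_source hx
  have hcont : ContinuousAt φ.symm (φ x) := φ.continuousAt_symm hφx
  have hcd : ContDiffAt ℝ ∞ (k ∘ φ.symm) (φ x) := by
    rw [← contMDiffAt_iff_contDiffAt]
    refine ContMDiffAt.comp (I' := 𝓘(ℝ, Plane)) _ (by rw [hsx]; exact hk.1) ?_
    exact (contMDiffOn_symm_of_mem_maximalAtlas h.1.1).contMDiffAt (φ.open_target.mem_nhds hφx)
  have hkd : ∀ᶠ x' in 𝓝 x, MDifferentiableAt 𝓘(ℝ, Plane) 𝓘(ℝ, F) k x' := by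
    have h1 : ContMDiffAt 𝓘(ℝ, Plane) 𝓘(ℝ, F) 1 k x := hk.1.of_le (by simp)
    filter_upwards [(contMDiffAt_iff_contMDiffAt_nhds (by simp)).1 h1] with x' hx' using hx'.mdifferentiableAt (by simp)
  have hev : ∀ᶠ y in 𝓝 (φ x), ∀ v w : Plane,
      inner ℝ (fderiv ℝ (k ∘ φ.symm) y v) (fderiv ℝ (k ∘ φ.symm) y w) = inner ℝ v w := by
    have e1 : ∀ᶠ y in 𝓝 (φ x), _ := hcont.eventually (hsx.symm ▸ hkd)
    have e2 : ∀ᶠ y in 𝓝 (φ x), _ := hcont.eventually (hsx.symm ▸ hk.2)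
    filter_upwards [e1, e2, φ.open_target.mem_nhds hφx] with y h1 h2 hy v w
    have hc : ∀ v : Plane, fderiv ℝ (k ∘ φ.symm) y v =
        mfderiv 𝓘(ℝ, Plane) 𝓘(ℝ, F) k (φ.symm y)
          (mfderiv 𝓘(ℝ, Plane) 𝓘(ℝ, Plane) φ.symm y v) := fun v => by
      rw [← mfderiv_eq_fderiv,
        mfderiv_comp y h1 (h.1.mdifferentiable.mdifferentiableAt_symm hy)]
      rfl
    rw [hc, hc, ← h.metricInChart_eq hy v w]
    exact (h2 _ _).symm
  obtain ⟨L, hL⟩ := eventually_affine_of_isometric (by simp [hF])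
    (hcd.of_le ENat.LEInfty.out) hev
  refine ⟨L, ?_⟩
  filter_upwards [(φ.continuousAt hx).eventually hL, φ.open_source.mem_nhds hx] with x' h1 h2
  simpa [φ.left_inv h2, hsx] using h1

theorem IsConeChart.isFlatMapAt {P : Set S} {g : BilinField S} {p : S} {θ R : ℝ}
    {Φ : OpenPartialHomeomorph S Plane} (h : IsConeChart P g p θ R Φ) [T1Space S] {x : S}
    (hx : x ∈ Φ.source \ {p}) {y₀ : Plane} (h₀ : y₀ ≠ 0)
    (hy : planeToComplex (Φ x) / planeToComplex y₀ ∈ Complex.slitPlane) :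
    IsFlatMapAt g (develop (θ / (2 * Real.pi)) y₀ ∘ Φ) x := by
  have hopen : IsOpen (Φ.source \ {p}) := Φ.open_source.sdiff isClosed_singleton
  refine ⟨?_, ?_⟩
  · exact ((contDiffAt_develop _ hy).contMDiffAt).comp x
      (h.smooth.contMDiffAt (hopen.mem_nhds hx))
  · have hev : ∀ᶠ x' in 𝓝 x, planeToComplex (Φ x') / planeToComplex y₀ ∈ Complex.slitPlane := by
      have hc : ContinuousAt (fun x' => planeToComplex (Φ x') / planeToComplex y₀) x :=
        (planeToComplex.continuous.continuousAt.comp (Φ.continuousAt hx.1)).div_const _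
      exact hc.eventually_mem (Complex.isOpen_slitPlane.mem_nhds hy)
    filter_upwards [hopen.mem_nhds hx, hev] with x' hx' hs v w
    have hne : Φ x' ≠ 0 := fun h0 => hx'.2 (by
      rw [← h.map_center] at h0
      exact Φ.injOn hx'.1 h.mem_source h0)
    have hc : ∀ v, mfderiv 𝓘(ℝ, Plane) 𝓘(ℝ, ℂ) (develop (θ / (2 * Real.pi)) y₀ ∘ Φ) x' v =
        fderiv ℝ (develop (θ / (2 * Real.pi)) y₀) (Φ x')
          (mfderiv 𝓘(ℝ, Plane) 𝓘(ℝ, Plane) Φ x' v) := fun v => by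
      rw [mfderiv_comp (I' := 𝓘(ℝ, Plane)) x'
        ((contDiffAt_develop _ hs).contMDiffAt.mdifferentiableAt (by simp))
        ((h.smooth.contMDiffAt (hopen.mem_nhds hx')).mdifferentiableAt (by simp)),
        mfderiv_eq_fderiv]
      rfl
    rw [h.isometric x' hx']
    simp only [hc]
    exact (inner_fderiv_develop θ h₀ hne hs _ _).symm

theorem IsConeChart.map_ne_zero {P : Set S} {g : BilinField S} {p : S} {θ R : ℝ}
    {Φ : OpenPartialHomeomorph S Plane} (h : IsConeChart P g p θ R Φ) {x : S}
    (hx : x ∈ Φ.source \ {p}) : Φ x ≠ 0 := fun h0 => hx.2 (by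
  rw [← h.map_center] at h0
  exact Φ.injOn hx.1 h.mem_source h0)

end LocalIsometry

/-! ### Straight paths -/

namespace ConeSurface

variable {S : Type*} [TopologicalSpace S] [ChartedSpace Plane S] (X : ConeSurface S)

/-- Near the time `s` the path `c` runs with constant velocity of squared length `q` in a flat
chart. -/
def IsStraightAt (q : ℝ) (c : ℝ → S) (s : ℝ) : Prop :=
  ∃ φ : OpenPartialHomeomorph S Plane, IsFlatChart (X.sing : Set S) X.metric φ ∧
    c s ∈ φ.source ∧ ∃ V : Plane, ‖V‖ ^ 2 = q ∧ ∀ᶠ u in 𝓝 s, φ (c u) = φ (c s) + (u - s) • V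

theorem IsStraightAt.nonneg {X : ConeSurface S} {q : ℝ} {c : ℝ → S} {s : ℝ}
    (h : X.IsStraightAt q c s) : 0 ≤ q := by
  obtain ⟨φ, hφ, hsφ, V, hV, hev⟩ := h
  rw [← hV]; positivity

variable {X} [IsManifold 𝓘(ℝ, Plane) ∞ S] {q : ℝ} {c : ℝ → S} {s : ℝ}

/-- Two flat maps differ by an affine isometry, which preserves lines and the length of their
velocities. -/
theorem isStraightAt_iff {F : Type*} [NormedAddCommGroup F] [InnerProductSpace ℝ F]
    [FiniteDimensional ℝ F] (hF : Module.finrank ℝ F = 2) (hs : c s ∉ X.sing)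
    (hc : ContinuousAt c s) {k : S → F} (hk : IsFlatMapAt X.metric k (c s)) :
    X.IsStraightAt q c s ↔
      ∃ W : F, ‖W‖ ^ 2 = q ∧ ∀ᶠ u in 𝓝 s, k (c u) = k (c s) + (u - s) • W := by
  constructor
  · rintro ⟨φ, hφ, hsφ, V, hV, hev⟩
    obtain ⟨L, hL⟩ := hk.eventually_affine hF hφ hsφ
    refine ⟨L V, by simpa using hV, ?_⟩
    filter_upwards [hev, hc.eventually hL] with u h1 h2
    rw [h2, h1]; simp
  · rintro ⟨W, hW, hev⟩
    obtain ⟨φ, hφ, hsφ⟩ := X.flat _ hs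
    obtain ⟨L, hL⟩ := hk.eventually_affine hF hφ hsφ
    refine ⟨φ, hφ, hsφ, L.symm W, by simpa using hW, ?_⟩
    filter_upwards [hev, hc.eventually hL] with u h1 h2
    rw [h1] at h2
    have h3 := congrArg L.symm (add_left_cancel h2)
    simp only [map_smul, LinearIsometryEquiv.symm_apply_apply] at h3
    rw [h3]; abel

end ConeSurface

/-! ### Velocities and the geodesic equation on the surface -/

namespace ConeSurface

section Velocity

variable {S : Type*} [TopologicalSpace S] [ChartedSpace Plane S]
  {φ : OpenPartialHomeomorph S Plane} {c : ℝ → S} {s : ℝ} {V : Plane}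

theorem hasMFDerivAt_of_hasDerivAt (hφ : φ.MDifferentiable 𝓘(ℝ, Plane) 𝓘(ℝ, Plane))
    (hc : ContinuousAt c s) (hs : c s ∈ φ.source) (hV : HasDerivAt (fun u => φ (c u)) V s) :
    HasMFDerivAt 𝓘(ℝ, ℝ) 𝓘(ℝ, Plane) c s
      (((mfderiv 𝓘(ℝ, Plane) 𝓘(ℝ, Plane) φ.symm (φ (c s)) : Plane →L[ℝ] Plane).comp
        (ContinuousLinearMap.toSpanSingleton ℝ V) : ℝ →L[ℝ] Plane)) := by
  have h1 : HasMFDerivAt 𝓘(ℝ, ℝ) 𝓘(ℝ, Plane) (fun u => φ (c u)) s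
      (ContinuousLinearMap.toSpanSingleton ℝ V) := hV.hasFDerivAt.hasMFDerivAt
  have h2 := (hφ.mdifferentiableAt_symm (φ.map_source hs)).hasMFDerivAt
  refine (h2.comp s h1).congr_of_eventuallyEq ?_
  filter_upwards [hc.eventually_mem (φ.open_source.mem_nhds hs)] with u hu
  exact (φ.left_inv hu).symm

theorem velocity_eq (hφ : φ.MDifferentiable 𝓘(ℝ, Plane) 𝓘(ℝ, Plane))
    (hc : ContinuousAt c s) (hs : c s ∈ φ.source) (hV : HasDerivAt (fun u => φ (c u)) V s) :
    velocity c s = (mfderiv 𝓘(ℝ, Plane) 𝓘(ℝ, Plane) φ.symm (φ (c s)) : Plane →L[ℝ] Plane) V := by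
  rw [velocity, (hasMFDerivAt_of_hasDerivAt hφ hc hs hV).mfderiv]
  exact (congrArg _ (one_smul ℝ V))

theorem covector_velocity (hφ : φ.MDifferentiable 𝓘(ℝ, Plane) 𝓘(ℝ, Plane))
    (hc : ContinuousAt c s) (hs : c s ∈ φ.source) (hV : HasDerivAt (fun u => φ (c u)) V s)
    (η : CovectorField S) :
    η (c s) (velocity c s) = covectorInChart η φ (φ (c s)) V := by
  rw [velocity_eq hφ hc hs hV]
  -- The tangent spaces at `φ.symm (φ (c s))` and `c s` are distinct types that both unfold to
  -- `Plane`; stating the equality on `Plane` allows substitution of the base point.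
  have h : ∀ x, x = c s → ∀ w : Plane, (η (c s) : Plane →L[ℝ] ℝ) w = (η x : Plane →L[ℝ] ℝ) w := by
    rintro x rfl w; rfl
  exact h _ (φ.left_inv hs) _

theorem metric_velocity (hφ : φ.MDifferentiable 𝓘(ℝ, Plane) 𝓘(ℝ, Plane))
    (hc : ContinuousAt c s) (hs : c s ∈ φ.source) (hV : HasDerivAt (fun u => φ (c u)) V s)
    (g : BilinField S) :
    g (c s) (velocity c s) (velocity c s) = metricInChart g φ (φ (c s)) V V := by
  rw [velocity_eq hφ hc hs hV]
  have h : ∀ x, x = c s → ∀ w : Plane, (g (c s) : Plane →L[ℝ] Plane →L[ℝ] ℝ) w w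
      = (g x : Plane →L[ℝ] Plane →L[ℝ] ℝ) w w := by
    rintro x rfl w; rfl
  exact h _ (φ.left_inv hs) _

theorem hasDerivAt_comp_curve (hφ : φ.MDifferentiable 𝓘(ℝ, Plane) 𝓘(ℝ, Plane))
    (hc : ContinuousAt c s) (hs : c s ∈ φ.source) (hV : HasDerivAt (fun u => φ (c u)) V s)
    {F : Type*} [NormedAddCommGroup F] [NormedSpace ℝ F] {k : S → F}
    {D : Plane →L[ℝ] F} (hk : HasMFDerivAt 𝓘(ℝ, Plane) 𝓘(ℝ, F) k (c s) D) :
    HasDerivAt (fun u => k (c u)) (D (velocity c s)) s := by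
  obtain ⟨D', hD'⟩ : ∃ D' : ℝ →L[ℝ] Plane, D' = mfderiv 𝓘(ℝ, ℝ) 𝓘(ℝ, Plane) c s := ⟨_, rfl⟩
  have h1 : HasMFDerivAt 𝓘(ℝ, ℝ) 𝓘(ℝ, Plane) c s D' :=
    hD' ▸ (hasMFDerivAt_of_hasDerivAt hφ hc hs hV).mdifferentiableAt.hasMFDerivAt
  have h2 : HasFDerivAt (fun u => k (c u)) (D.comp D') s := (hk.comp s h1).hasFDerivAt
  have h3 : D' 1 = velocity c s := by rw [hD']; rfl
  rw [← h3]
  exact h2.hasDerivAt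

end Velocity

variable {S : Type*} [TopologicalSpace S] [ChartedSpace Plane S] (X : ConeSurface S)

/-- The path `c` is differentiable near `s` and its acceleration vanishes at `s`, in a flat chart. -/
def IsFreeAt (c : ℝ → S) (s : ℝ) : Prop :=
  ∃ φ : OpenPartialHomeomorph S Plane, IsFlatChart (X.sing : Set S) X.metric φ ∧
    c s ∈ φ.source ∧ ∃ V : ℝ → Plane, (∀ᶠ u in 𝓝 s, HasDerivAt (fun u => φ (c u)) (V u) u) ∧
      HasDerivAt V 0 s

variable {X} [IsManifold 𝓘(ℝ, Plane) ∞ S] {q : ℝ} {c : ℝ → S} {s : ℝ}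

theorem hasDerivAt_zero_of_inner {V : ℝ → Plane}
    (h : ∀ w : Plane, HasDerivAt (fun u => inner ℝ (V u) w) (0 : ℝ) s) : HasDerivAt V 0 s := by
  let b := EuclideanSpace.basisFun (Fin 2) ℝ
  have h1 : HasDerivAt (fun u => ∑ i, inner ℝ (V u) (b i) • b i) (∑ i, (0 : ℝ) • b i) s :=
    HasDerivAt.fun_sum fun i _ => (h (b i)).smul_const (b i)
  simp only [zero_smul, Finset.sum_const_zero] at h1
  have h2 : (fun u => ∑ i, inner ℝ (V u) (b i) • b i) = V := by
    funext u
    conv_rhs => rw [← b.sum_repr' (V u)]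
    simp only [real_inner_comm]
  rwa [h2] at h1

/-- The metric coefficients are constant in a flat chart, so the right-hand side of the geodesic
equation vanishes. -/
theorem solvesGeodesicEq_metricInChart_iff {φ : OpenPartialHomeomorph S Plane}
    (hφ : IsFlatChart (X.sing : Set S) X.metric φ) (hc : ContinuousAt c s) (hs : c s ∈ φ.source) :
    SolvesGeodesicEq (metricInChart X.metric φ) (fun u => φ (c u)) s ↔
      ∃ V : ℝ → Plane, (∀ᶠ u in 𝓝 s, HasDerivAt (fun u => φ (c u)) (V u) u) ∧
        HasDerivAt V 0 s := by
  refine exists_congr fun V => and_congr_right fun _ => ?_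
  have e1 : ∀ w, (fun u => metricInChart X.metric φ (φ (c u)) (V u) w) =ᶠ[𝓝 s]
      fun u => inner ℝ (V u) w := fun w => by
    filter_upwards [hc.eventually_mem (φ.open_source.mem_nhds hs)] with u hu
    exact hφ.metricInChart_eq (φ.map_source hu) _ _
  have e2 : fderiv ℝ (fun y => metricInChart X.metric φ y (V s) (V s)) (φ (c s)) = 0 := by
    have : (fun y => metricInChart X.metric φ y (V s) (V s)) =ᶠ[𝓝 (φ (c s))]
        fun _ => inner ℝ (V s) (V s) := by
      filter_upwards [φ.open_target.mem_nhds (φ.map_source hs)] with y hy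
      exact hφ.metricInChart_eq hy _ _
    rw [this.fderiv_eq, fderiv_fun_const]; rfl
  constructor
  · intro h
    apply hasDerivAt_zero_of_inner
    intro w
    have := h w
    simp only [e2, zero_apply, mul_zero] at this
    exact this.congr_of_eventuallyEq (e1 w).symm
  · intro h w
    simp only [e2, zero_apply, mul_zero]
    refine HasDerivAt.congr_of_eventuallyEq ?_ (e1 w)
    simpa using h.inner ℝ (hasDerivAt_const s w)

/-- `IsFreeAt` controls the acceleration at a single time, in a chart that depends on that time.
Affine transition maps carry all these statements to one chart, where the velocity then has zero
derivative on a whole interval. -/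
theorem isStraightAt_of_isFreeAt {I : Set ℝ} (hI : IsOpen I) (hc : ContinuousOn c I)
    (h : ∀ u ∈ I, c u ∉ X.sing → X.IsFreeAt c u) (hs : s ∈ I) (hreg : c s ∉ X.sing) :
    ∃ q, X.IsStraightAt q c s := by
  obtain ⟨φ, hφ, hsφ, V, hV, -⟩ := h s hs hreg
  have hcat : ∀ u ∈ I, ContinuousAt c u := fun u hu => hc.continuousAt (hI.mem_nhds hu)
  have hacc : ∀ᶠ u in 𝓝 s, HasDerivAt V 0 u := by
    filter_upwards [hV.eventually_nhds, hI.mem_nhds hs,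
      (hcat s hs).eventually_mem (φ.open_source.mem_nhds hsφ)] with u hVu hu hus
    obtain ⟨ψ, hψ, huψ, W, hW, hW0⟩ := h u hu fun hP => hφ.1.2 hus hP
    obtain ⟨L, hL⟩ := (hφ.isFlatMapAt hus).eventually_affine (by simp) hψ huψ
    have e1 : (fun v => φ (c v)) =ᶠ[𝓝 u] fun v => φ (c u) + L (ψ (c v) - ψ (c u)) :=
      (hcat u hu).eventually hL
    have e2 : V =ᶠ[𝓝 u] fun v => L (W v) := by
      filter_upwards [hVu, hW, e1.eventuallyEq_nhds] with v h1 h2 h3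
      refine h1.unique (HasDerivAt.congr_of_eventuallyEq ?_ h3)
      have := (L.toContinuousLinearEquiv : Plane →L[ℝ] Plane).hasFDerivAt.comp_hasDerivAt v
        (h2.sub_const (ψ (c u)))
      exact this.const_add _
    refine HasDerivAt.congr_of_eventuallyEq ?_ e2
    have : HasDerivAt (fun v => L (W v)) (L 0) u :=
      (L.toContinuousLinearEquiv : Plane →L[ℝ] Plane).hasFDerivAt.comp_hasDerivAt u hW0
    simpa using this
  obtain ⟨ε, hε, hball⟩ := Metric.eventually_nhds_iff_ball.1 (hV.and hacc)
  refine ⟨_, φ, hφ, hsφ, V s, rfl, ?_⟩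
  have hpre : IsPreconnected (Metric.ball s ε) := (convex_ball s ε).isPreconnected
  have hs₀ : s ∈ Metric.ball s ε := Metric.mem_ball_self hε
  have hconst : ∀ u ∈ Metric.ball s ε, V u = V s := fun u hu =>
    Metric.isOpen_ball.is_const_of_deriv_eq_zero (𝕜 := ℝ) hpre
      (fun z hz => (hball z hz).2.differentiableAt.differentiableWithinAt)
      (fun z hz => (hball z hz).2.deriv) hu hs₀
  have hd : ∀ u ∈ Metric.ball s ε, HasDerivAt (fun u => φ (c u) - (u - s) • V s) 0 u := by
    intro u hu
    have := (hball u hu).1.fun_sub (((hasDerivAt_id u).sub_const s).smul_const (V s))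
    rw [hconst u hu] at this
    simpa using this
  filter_upwards [Metric.ball_mem_nhds s hε] with u hu
  have := Metric.isOpen_ball.is_const_of_deriv_eq_zero (𝕜 := ℝ) hpre
      (fun z hz => (hd z hz).differentiableAt.differentiableWithinAt)
      (fun z hz => (hd z hz).deriv) hu hs₀
  simp only [sub_self, zero_smul, sub_zero] at this
  rw [← this]; abel

theorem hasDerivAt_of_eventually_line {F : Type*} [NormedAddCommGroup F] [NormedSpace ℝ F]
    {γ : ℝ → F} {A V : F} (h : ∀ᶠ u in 𝓝 s, γ u = A + (u - s) • V) :
    ∀ᶠ u in 𝓝 s, HasDerivAt γ V u := by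
  filter_upwards [h.eventually_nhds] with u hu
  refine HasDerivAt.congr_of_eventuallyEq ?_ hu
  simpa using (((hasDerivAt_id u).sub_const s).smul_const V).const_add A

theorem IsStraightAt.metric_velocity (h : X.IsStraightAt q c s) (hc : ContinuousAt c s) :
    X.metric (c s) (velocity c s) (velocity c s) = q := by
  obtain ⟨φ, hφ, hsφ, V, hV, hev⟩ := h
  rw [ConeSurface.metric_velocity hφ.1.mdifferentiable hc hsφ
    (hasDerivAt_of_eventually_line hev).self_of_nhds,
    hφ.metricInChart_eq (φ.map_source hsφ), real_inner_self_eq_norm_sq, hV]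

variable (X) in
/-- Near `s` the path `c` is a geodesic of squared speed `q` that meets the cone points at isolated
times only. -/
structure IsGeodesicAt (q : ℝ) (c : ℝ → S) (s : ℝ) : Prop where
  continuousAt : ContinuousAt c s
  straight : c s ∉ X.sing → X.IsStraightAt q c s
  isolated : c s ∈ X.sing → ∀ᶠ u in 𝓝[≠] s, c u ∉ X.sing

/-- Constancy of the speed provides one `q` for all the straight pieces. Paths resting at a cone
point are kept apart, since they violate isolation of singular times. -/
theorem isSurfaceGeodesic_iff {I : Set ℝ} (hI : IsOpenInterval I) :
    X.IsSurfaceGeodesic c I ↔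
      (∃ q, ∀ s ∈ I, X.IsGeodesicAt q c s) ∨ ∃ p ∈ X.sing, ∀ s ∈ I, c s = p := by
  constructor
  · rintro ⟨hc, hg, ⟨q, hq⟩, h | h⟩
    · left
      have hcat : ∀ u ∈ I, ContinuousAt c u := fun u hu => hc.continuousAt (hI.1.mem_nhds hu)
      refine ⟨q, fun s hs => ⟨hcat s hs, fun hreg => ?_, h s hs⟩⟩
      have hfree : ∀ u ∈ I, c u ∉ X.sing → X.IsFreeAt c u := fun u hu hur => by
        obtain ⟨φ, hφ, huφ, hsol⟩ := hg u hu hur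
        exact ⟨φ, hφ, huφ, (solvesGeodesicEq_metricInChart_iff hφ (hcat u hu) huφ).1 hsol⟩
      obtain ⟨q', hq'⟩ := isStraightAt_of_isFreeAt hI.1 hc hfree hs hreg
      rwa [← hq s hs hreg, hq'.metric_velocity (hcat s hs)]
    · exact Or.inr h
  · rintro (⟨q, h⟩ | ⟨p, hp, h⟩)
    · refine ⟨fun s hs => (h s hs).continuousAt.continuousWithinAt, fun s hs hreg => ?_,
        ⟨q, fun s hs hreg => ((h s hs).straight hreg).metric_velocity (h s hs).continuousAt⟩,
        Or.inl fun s hs => (h s hs).isolated⟩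
      obtain ⟨φ, hφ, hsφ, V, -, hev⟩ := (h s hs).straight hreg
      refine ⟨φ, hφ, hsφ,
        (solvesGeodesicEq_metricInChart_iff hφ (h s hs).continuousAt hsφ).2
          ⟨fun _ => V, hasDerivAt_of_eventually_line hev, hasDerivAt_const s V⟩⟩
    · have hreg : ∀ s ∈ I, c s ∉ X.sing → False := fun s hs hn => hn (by rwa [h s hs])
      exact ⟨continuousOn_const.congr h, fun s hs hn => (hreg s hs hn).elim,
        ⟨0, fun s hs hn => (hreg s hs hn).elim⟩, Or.inr ⟨p, hp, h⟩⟩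

end ConeSurface

/-! ### Ends of paths, and quadratic functions -/

/-- A path in a compact Hausdorff space whose cluster points at the end of its interval all lie in
a finite set converges to a point of that set. -/
theorem exists_clusterPt_or_tendsto {S : Type*} [TopologicalSpace S] [T2Space S] [CompactSpace S]
    {c : ℝ → S} {a b : ℝ} (hab : a < b) (hc : ContinuousOn c (Ioo a b)) (P : Finset S) :
    (∃ x ∉ P, MapClusterPt x (𝓝[<] b) c) ∨ ∃ p ∈ P, Filter.Tendsto c (𝓝[<] b) (𝓝 p) := by
  by_contra! H
  obtain ⟨H1, H2⟩ := H
  obtain ⟨U, hU, hdisj⟩ := P.finite_toSet.t2_separation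
  have hO : IsOpen (⋃ p ∈ P, U p) := isOpen_biUnion fun p _ => (hU p).2
  have hev : ∀ᶠ u in 𝓝[<] b, c u ∈ ⋃ p ∈ P, U p := by
    by_contra hne
    have hfr : ∃ᶠ u in 𝓝[<] b, c u ∈ (⋃ p ∈ P, U p)ᶜ :=
      Filter.not_eventually.1 hne
    obtain ⟨x, hx, hxc⟩ := hO.isClosed_compl.isCompact.exists_mapClusterPt_of_frequently hfr
    by_cases hxP : x ∈ P
    · exact hx (mem_biUnion (show x ∈ (P : Set S) from hxP) (hU x).1)
    · exact H1 x hxP hxc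
  obtain ⟨s, hs, hsub⟩ := (mem_nhdsLT_iff_exists_Ioo_subset' hab).1
    (Filter.inter_mem hev (Ioo_mem_nhdsLT hab))
  have hsb : s < b := hs
  obtain ⟨m, hm⟩ : (Ioo s b).Nonempty := nonempty_Ioo.2 hsb
  obtain ⟨p, hp, hmp⟩ := mem_iUnion₂.1 (hsub hm).1
  -- The tail of the path is connected and covered by the disjoint sets `U r`, so it lies in a
  -- single `U p`. Then `p` is the only possible cluster point, which by compactness makes it the
  -- limit.
  have hpre : IsPreconnected (c '' Ioo s b) :=
    isPreconnected_Ioo.image c (hc.mono fun u hu => (hsub hu).2)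
  have hO' : IsOpen (⋃ r ∈ (P : Set S) \ {p}, U r) := isOpen_biUnion fun r _ => (hU r).2
  have hsubp : c '' Ioo s b ⊆ U p := by
    refine hpre.subset_left_of_subset_union (hU p).2 hO' ?_ ?_ ⟨c m, mem_image_of_mem c hm, hmp⟩
    · rw [disjoint_iUnion₂_right]
      exact fun r hr => hdisj hp hr.1 (fun h => hr.2 h.symm)
    · rintro _ ⟨u, hu, rfl⟩
      obtain ⟨r, hr, hur⟩ := mem_iUnion₂.1 (hsub hu).1
      by_cases hrp : r = p
      · left; rwa [hrp] at hur
      · right; exact mem_biUnion (show r ∈ (P : Set S) \ {p} from ⟨hr, hrp⟩) hur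
  refine H2 p hp ?_
  refine isCompact_univ.le_nhds_of_unique_clusterPt (Filter.univ_mem) fun x _ hx => ?_
  by_contra hxp
  have hxP : x ∈ P := by_contra fun h => H1 x h hx
  have hfr := MapClusterPt.frequently hx ((hU x).2.mem_nhds (hU x).1)
  have hev2 : ∀ᶠ u in 𝓝[<] b, u ∈ Ioo s b := Ioo_mem_nhdsLT hsb
  obtain ⟨u, hu1, hu2⟩ := (hfr.and_eventually hev2).exists
  exact disjoint_left.1 (hdisj hxP hp hxp) hu1 (hsubp (mem_image_of_mem c hu2))

/-- A function that is locally quadratic with leading coefficient `q` is globally so. -/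
theorem exists_quadratic {r : ℝ → ℝ} {a b q : ℝ}
    (h : ∀ u ∈ Ioo a b, ∃ m, ∀ᶠ v in 𝓝 u, r v = r u + m * (v - u) + q * (v - u) ^ 2) :
    ∃ α β, ∀ v ∈ Ioo a b, r v = α + β * v + q * v ^ 2 := by
  rcases (Ioo a b).eq_empty_or_nonempty with he | ⟨u₀, hu₀⟩
  · exact ⟨0, 0, by simp [he]⟩
  set t : ℝ → ℝ := fun v => r v - q * v ^ 2 with ht
  have hloc : ∀ u ∈ Ioo a b, ∃ m, ∀ᶠ v in 𝓝 u, HasDerivAt t m v := by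
    intro u hu
    obtain ⟨m, hm⟩ := h u hu
    refine ⟨m - 2 * q * u, ?_⟩
    refine ConeSurface.hasDerivAt_of_eventually_line (A := r u - q * u ^ 2) ?_
    filter_upwards [hm] with v hv
    rw [ht]; simp only [hv, smul_eq_mul]; ring
  have hd2 : ∀ u ∈ Ioo a b, HasDerivAt (deriv t) 0 u := fun u hu => by
    obtain ⟨m, hm⟩ := hloc u hu
    exact (hasDerivAt_const u m).congr_of_eventuallyEq (hm.mono fun v hv => hv.deriv)
  have hconst : ∀ u ∈ Ioo a b, deriv t u = deriv t u₀ := fun u hu =>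
    isOpen_Ioo.is_const_of_deriv_eq_zero (𝕜 := ℝ) isPreconnected_Ioo
      (fun z hz => (hd2 z hz).differentiableAt.differentiableWithinAt)
      (fun z hz => (hd2 z hz).deriv) hu hu₀
  have hd : ∀ u ∈ Ioo a b, HasDerivAt (fun v => t v - deriv t u₀ * v) 0 u := fun u hu => by
    obtain ⟨m, hm⟩ := hloc u hu
    have h1 := hm.self_of_nhds.differentiableAt.hasDerivAt.fun_sub
      ((hasDerivAt_id u).const_mul (deriv t u₀))
    rw [hconst u hu] at h1
    simpa using h1
  refine ⟨t u₀ - deriv t u₀ * u₀, deriv t u₀, fun v hv => ?_⟩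
  have h1 := isOpen_Ioo.is_const_of_deriv_eq_zero (𝕜 := ℝ) isPreconnected_Ioo
      (fun z hz => (hd z hz).differentiableAt.differentiableWithinAt)
      (fun z hz => (hd z hz).deriv) hv hu₀
  simp only [ht] at h1 ⊢
  linarith

/-- A convex quadratic that vanishes at both ends of an interval is not positive inside. -/
theorem quadratic_false {r : ℝ → ℝ} {a b q : ℝ} (hab : a < b) (hq : 0 ≤ q)
    (h : ∀ u ∈ Ioo a b, ∃ m, ∀ᶠ v in 𝓝 u, r v = r u + m * (v - u) + q * (v - u) ^ 2)
    (hpos : ∀ u ∈ Ioo a b, 0 < r u) (ha : Filter.Tendsto r (𝓝[>] a) (𝓝 0))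
    (hb : Filter.Tendsto r (𝓝[<] b) (𝓝 0)) : False := by
  obtain ⟨α, β, hr⟩ := exists_quadratic h
  have hcont : Continuous fun v : ℝ => α + β * v + q * v ^ 2 := by fun_prop
  have ha' : α + β * a + q * a ^ 2 = 0 := by
    refine tendsto_nhds_unique ((hcont.tendsto a).mono_left nhdsWithin_le_nhds) (ha.congr' ?_)
    filter_upwards [Ioo_mem_nhdsGT hab] with v hv using hr v hv
  have hb' : α + β * b + q * b ^ 2 = 0 := by
    refine tendsto_nhds_unique ((hcont.tendsto b).mono_left nhdsWithin_le_nhds) (hb.congr' ?_)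
    filter_upwards [Ioo_mem_nhdsLT hab] with v hv using hr v hv
  obtain ⟨m, hm⟩ := nonempty_Ioo.2 hab
  have h1 := hpos m hm
  rw [hr m hm] at h1
  have h2 : (α + β * m + q * m ^ 2) * (b - a) = - (q * ((m - a) * (b - m) * (b - a))) := by
    linear_combination (b - m) * ha' + (m - a) * hb'
  have h3 : 0 ≤ q * ((m - a) * (b - m) * (b - a)) := by
    have := sub_pos.2 hm.1; have := sub_pos.2 hm.2; have := sub_pos.2 hab; positivity
  have := mul_pos h1 (sub_pos.2 hab)
  linarith

/-! ### Continuation at a regular point -/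

namespace ConeSurface

variable {S : Type*} [TopologicalSpace S] [ChartedSpace Plane S] {X : ConeSurface S}
  {q : ℝ} {c d : ℝ → S} {s : ℝ}

theorem IsStraightAt.congr (h : X.IsStraightAt q c s) (hcd : c =ᶠ[𝓝 s] d) :
    X.IsStraightAt q d s := by
  obtain ⟨φ, hφ, hs, V, hV, hev⟩ := h
  refine ⟨φ, hφ, hcd.self_of_nhds ▸ hs, V, hV, ?_⟩
  filter_upwards [hev, hcd] with u h1 h2
  rw [← h2, h1, hcd.self_of_nhds]

theorem IsGeodesicAt.congr (h : X.IsGeodesicAt q c s) (hcd : c =ᶠ[𝓝 s] d) :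
    X.IsGeodesicAt q d s := by
  refine ⟨h.continuousAt.congr hcd, fun hs => (h.straight ?_).congr hcd, fun hs => ?_⟩
  · rwa [hcd.self_of_nhds]
  · filter_upwards [h.isolated (by rwa [hcd.self_of_nhds]), hcd.filter_mono nhdsWithin_le_nhds]
      with u h1 h2
    rwa [← h2]

/-- Time reversal reduces extension to the left to extension to the right. -/
theorem IsGeodesicAt.comp_neg (h : X.IsGeodesicAt q c s) :
    X.IsGeodesicAt q (fun u => c (-u)) (-s) := by
  have hneg : Filter.Tendsto (fun u : ℝ => -u) (𝓝 (-s)) (𝓝 s) := by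
    simpa using (continuous_neg.tendsto (-s))
  refine ⟨?_, fun hs => ?_, fun hs => ?_⟩
  · have h1 := h.continuousAt
    unfold ContinuousAt
    simp only [neg_neg]
    exact Filter.Tendsto.comp h1 hneg
  · simp only [neg_neg] at hs
    obtain ⟨φ, hφ, hsφ, V, hV, hev⟩ := h.straight hs
    refine ⟨φ, hφ, by simpa using hsφ, -V, by simpa using hV, ?_⟩
    filter_upwards [hneg.eventually hev] with u hu
    rw [hu, neg_neg, smul_neg, ← neg_smul]
    congr 2; ring
  · simp only [neg_neg] at hs
    have hneg' : Filter.Tendsto (fun u : ℝ => -u) (𝓝[≠] (-s)) (𝓝[≠] s) := by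
      refine tendsto_nhdsWithin_iff.2 ⟨hneg.mono_left nhdsWithin_le_nhds, ?_⟩
      filter_upwards [self_mem_nhdsWithin] with u hu h1
      exact hu (by rw [mem_singleton_iff] at h1 ⊢; linarith)
    exact hneg'.eventually (h.isolated hs)

variable [IsManifold 𝓘(ℝ, Plane) ∞ S]

/-- Two paths on a connected set of times that agree near one time agree throughout, if one of them
is a line in a flat chart and the other is a geodesic. -/
theorem eventuallyEq_of_line [T2Space S] {φ : OpenPartialHomeomorph S Plane}
    (hφ : IsFlatChart (X.sing : Set S) X.metric φ) {A V : Plane} {K : Set ℝ}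
    (hK : IsPreconnected K) (hline : ∀ u ∈ K, A + u • V ∈ φ.target)
    (hc : ∀ u ∈ K, X.IsGeodesicAt q c u) (hs : s ∈ K)
    (heq : c =ᶠ[𝓝 s] fun u => φ.symm (A + u • V)) :
    ∀ u ∈ K, c u = φ.symm (A + u • V) := by
  set d : ℝ → S := fun u => φ.symm (A + u • V) with hd
  suffices h : K ⊆ {u | c =ᶠ[𝓝 u] d} from fun u hu => (h hu).self_of_nhds
  -- The set of times near which the paths agree is open; by connectedness it suffices that it is
  -- closed relative to `K`.
  refine hK.subset_of_closure_inter_subset isOpen_setOfPred_eventually_nhds ⟨s, hs, heq⟩ ?_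
  rintro u ⟨hu, huK⟩
  have hlc : Continuous fun v : ℝ => A + v • V := by fun_prop
  have hdc : ContinuousAt d u :=
    ContinuousAt.comp (f := fun v : ℝ => A + v • V) (φ.continuousAt_symm (hline u huK))
      hlc.continuousAt
  have hfr : ∃ᶠ v in 𝓝 u, c =ᶠ[𝓝 v] d := mem_closure_iff_frequently.1 hu
  have hcd : c u = d u := by
    by_contra hne
    have h1 : ∀ᶠ v in 𝓝 u, c v ≠ d v :=
      ((hc u huK).continuousAt.prodMk hdc).eventually
        ((isOpen_ne_fun continuous_fst continuous_snd).mem_nhds hne)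
    obtain ⟨v, hv1, hv2⟩ := (hfr.and_eventually h1).exists
    exact hv2 hv1.self_of_nhds
  have hus : c u ∈ φ.source := hcd ▸ φ.map_target (hline u huK)
  have hreg : c u ∉ X.sing := fun h => hφ.1.2 hus h
  obtain ⟨W, -, hW⟩ := (isStraightAt_iff (by simp) hreg (hc u huK).continuousAt
    (hφ.isFlatMapAt hus)).1 ((hc u huK).straight hreg)
  have htgt : ∀ᶠ v in 𝓝 u, A + v • V ∈ φ.target :=
    hlc.continuousAt.eventually_mem (φ.open_target.mem_nhds (hline u huK))
  -- Near the limit time `c` is itself a line; comparing derivatives at a nearby time of local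
  -- agreement identifies the two velocities.
  have hWV : W = V := by
    obtain ⟨v, hv1, hv2, hv3⟩ := (hfr.and_eventually
      ((hasDerivAt_of_eventually_line hW).and htgt.eventually_nhds)).exists
    refine hv2.unique ?_
    have h1 : HasDerivAt (fun v : ℝ => A + v • V) V v := by
      simpa using ((hasDerivAt_id v).smul_const V).const_add A
    refine h1.congr_of_eventuallyEq ?_
    filter_upwards [hv1, hv3] with w h2 h3
    rw [h2, hd]; exact φ.right_inv h3
  filter_upwards [hW, htgt, (hc u huK).continuousAt.eventually_mem (φ.open_source.mem_nhds hus)]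
    with v h1 h2 h3
  refine φ.injOn h3 (φ.map_target h2) ?_
  rw [h1, hWV, hcd]
  simp only [hd, φ.right_inv h2, φ.right_inv (hline u huK)]
  module

/-- A geodesic with a regular cluster point at the end of its interval continues. -/
theorem exists_continuation_of_clusterPt [T2Space S] {a b : ℝ} (hab : a < b)
    (hc : ∀ u ∈ Ioo a b, X.IsGeodesicAt q c u) {x : S} (hx : x ∉ X.sing)
    (hcl : MapClusterPt x (𝓝[<] b) c) :
    ∃ d : ℝ → S, ∃ s ∈ Ioo a b, ∃ b' > b, (∀ u ∈ Ioo s b', X.IsGeodesicAt q d u) ∧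
      ∀ u ∈ Ioo s b, d u = c u := by
  obtain ⟨φ, hφ, hxφ⟩ := X.flat x hx
  obtain ⟨r, hr, hball⟩ := Metric.isOpen_iff.1 φ.open_target (φ x) (φ.map_source hxφ)
  -- Within time `2 * η` a path of speed `√q` covers at most `r / 2`; the `+ 1` keeps the
  -- denominator positive when `q = 0`.
  set η := r / (4 * (√q + 1)) with hη
  have hηpos : 0 < η := by positivity
  have hN : φ.source ∩ φ ⁻¹' Metric.ball (φ x) (r / 2) ∈ 𝓝 x :=
    Filter.inter_mem (φ.open_source.mem_nhds hxφ)
      ((φ.continuousAt hxφ).preimage_mem_nhds (Metric.ball_mem_nhds _ (by positivity)))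
  have hfr := MapClusterPt.frequently hcl hN
  have hev : ∀ᶠ u in 𝓝[<] b, u ∈ Ioo (max a (b - η)) b :=
    Ioo_mem_nhdsLT (max_lt hab (by linarith))
  obtain ⟨s, ⟨hs1, hs2⟩, hs3, hs4⟩ := (hfr.and_eventually hev).exists
  have hs5 : a < s := (le_max_left _ _).trans_lt hs3
  have hs6 : b - η < s := (le_max_right _ _).trans_lt hs3
  have hsab : s ∈ Ioo a b := ⟨hs5, hs4⟩
  have hreg : c s ∉ X.sing := fun h => hφ.1.2 hs1 h
  obtain ⟨V, hVq, hV⟩ := (isStraightAt_iff (by simp) hreg (hc s hsab).continuousAt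
    (hφ.isFlatMapAt hs1)).1 ((hc s hsab).straight hreg)
  have hVn : ‖V‖ = √q := by rw [← hVq, Real.sqrt_sq (norm_nonneg _)]
  set A := φ (c s) - s • V with hA
  have hline : ∀ u ∈ Ioo (b - η) (b + η), A + u • V ∈ φ.target := by
    intro u hu
    apply hball
    rw [mem_preimage, Metric.mem_ball] at hs2
    rw [Metric.mem_ball]
    have e : A + u • V = φ (c s) + (u - s) • V := by rw [hA]; module
    have h1 : |u - s| ≤ 2 * η := by rw [abs_le]; constructor <;> linarith [hu.1, hu.2]
    have h2 : ‖(u - s) • V‖ ≤ r / 2 := by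
      rw [norm_smul, hVn, Real.norm_eq_abs]
      calc |u - s| * √q ≤ 2 * η * (√q + 1) := by gcongr; linarith
        _ = r / 2 := by rw [hη]; field_simp; ring
    rw [e]
    calc dist (φ (c s) + (u - s) • V) (φ x) ≤ dist (φ (c s) + (u - s) • V) (φ (c s))
          + dist (φ (c s)) (φ x) := dist_triangle _ _ _
      _ < r / 2 + r / 2 := by
          rw [dist_self_add_left]; exact add_lt_add_of_le_of_lt h2 hs2
      _ = r := by ring
  refine ⟨fun u => φ.symm (A + u • V), s, hsab, b + η, by linarith, fun u hu => ?_, fun u hu => ?_⟩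
  · have hu' : u ∈ Ioo (b - η) (b + η) := ⟨by linarith [hu.1], hu.2⟩
    have hut := hline u hu'
    have hus := φ.map_target hut
    have hur : φ.symm (A + u • V) ∉ X.sing := fun h => hφ.1.2 hus h
    refine ⟨?_, fun _ => ⟨φ, hφ, hus, V, hVq, ?_⟩, fun h => (hur h).elim⟩
    · exact ContinuousAt.comp (f := fun v : ℝ => A + v • V) (φ.continuousAt_symm hut)
        (by fun_prop)
    · filter_upwards [isOpen_Ioo.mem_nhds hu'] with v hv
      rw [φ.right_inv (hline v hv), φ.right_inv hut]; module
  -- At time `s` the path is known to be close to `x`, but it could leave the chart before `b`.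
  -- Comparison with the line excludes this.
  · refine (eventuallyEq_of_line hφ (K := Ico s b) isPreconnected_Ico (fun v hv => ?_)
      (fun v hv => hc v ⟨hs5.trans_le hv.1, hv.2⟩) (left_mem_Ico.2 hs4) ?_ u
      ⟨hu.1.le, hu.2⟩).symm
    · exact hline v ⟨hs6.trans_le hv.1, by linarith [hv.2]⟩
    · filter_upwards [hV, (hc s hsab).continuousAt.eventually_mem (φ.open_source.mem_nhds hs1)]
        with v h1 h2
      rw [← φ.left_inv h2, h1, hA]
      congr 1; module

end ConeSurface

/-! ### Geodesics near a cone point -/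

namespace ConeSurface

variable {S : Type*} [TopologicalSpace S] [ChartedSpace Plane S] {X : ConeSurface S}
  {q θ R : ℝ} {c : ℝ → S} {p : S} {Φ : OpenPartialHomeomorph S Plane}

theorem _root_.IsConeChart.notMem_sing (hΦ : IsConeChart (X.sing : Set S) X.metric p θ R Φ) {x : S}
    (hx : x ∈ Φ.source \ {p}) : x ∉ X.sing := fun h => hx.2 (by
  have : x ∈ Φ.source ∩ (X.sing : Set S) := ⟨hx.1, h⟩
  rwa [hΦ.source_inter] at this)

theorem _root_.IsConeChart.mem_sing (hΦ : IsConeChart (X.sing : Set S) X.metric p θ R Φ) :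
    p ∈ X.sing := by
  have : p ∈ Φ.source ∩ (X.sing : Set S) := by rw [hΦ.source_inter]; rfl
  exact this.2

theorem _root_.IsConeChart.norm_sq_pos (hΦ : IsConeChart (X.sing : Set S) X.metric p θ R Φ) {x : S}
    (hx : x ∈ Φ.source \ {p}) : 0 < ‖Φ x‖ ^ 2 := by
  have := norm_pos_iff.2 (hΦ.map_ne_zero hx)
  positivity

theorem _root_.IsConeChart.tendsto_norm_sq (hΦ : IsConeChart (X.sing : Set S) X.metric p θ R Φ)
    {l : Filter ℝ} (h : Filter.Tendsto c l (𝓝 p)) :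
    Filter.Tendsto (fun u => ‖Φ (c u)‖ ^ 2) l (𝓝 0) := by
  have h1 : Filter.Tendsto Φ (𝓝 p) (𝓝 0) := hΦ.map_center ▸ Φ.continuousAt hΦ.mem_source
  simpa using ((h1.comp h).norm.pow 2)

/-- The angular momentum, with respect to the tip of a cone chart, of a path in a cone surface. -/
def angularMomentum (θ : ℝ) (Φ : OpenPartialHomeomorph S Plane) (c : ℝ → S) (u : ℝ) : ℝ :=
  θ / (2 * Real.pi) * ‖Φ (c u)‖ ^ 2 * angularForm (Φ (c u))
    (mfderiv 𝓘(ℝ, Plane) 𝓘(ℝ, Plane) Φ (c u) (velocity c u))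

variable [IsManifold 𝓘(ℝ, Plane) ∞ S] [T2Space S] {u : ℝ}

theorem _root_.IsConeChart.hasDerivAt_comp_curve
    (hΦ : IsConeChart (X.sing : Set S) X.metric p θ R Φ)
    (hg : X.IsGeodesicAt q c u) (hu : c u ∈ Φ.source \ {p}) :
    HasDerivAt (fun v => Φ (c v))
      (mfderiv 𝓘(ℝ, Plane) 𝓘(ℝ, Plane) Φ (c u) (velocity c u) : Plane) u := by
  obtain ⟨φ, hφ, huφ, V, -, hV⟩ := hg.straight (hΦ.notMem_sing hu)
  have hopen : IsOpen (Φ.source \ {p}) := Φ.open_source.sdiff isClosed_singleton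
  exact ConeSurface.hasDerivAt_comp_curve hφ.1.mdifferentiable hg.continuousAt huφ
    (hasDerivAt_of_eventually_line hV).self_of_nhds
    ((hΦ.smooth.contMDiffAt (hopen.mem_nhds hu)).mdifferentiableAt (by simp)).hasMFDerivAt

/-- The developed path is the segment $A+(v-u)W$. The developing map preserves the distance to the
tip and the angular momentum, so both can be read off from this segment. -/
theorem _root_.IsConeChart.exists_developed_line
    (hΦ : IsConeChart (X.sing : Set S) X.metric p θ R Φ)
    (hg : ∀ᶠ v in 𝓝 u, X.IsGeodesicAt q c v) (hu : c u ∈ Φ.source \ {p}) :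
    ∃ A W : ℂ, ‖W‖ ^ 2 = q ∧ ‖A‖ = ‖Φ (c u)‖ ∧ ∀ᶠ v in 𝓝 u, ‖Φ (c v)‖ = ‖A + (v - u) • W‖ ∧
      angularMomentum θ Φ c v = ((starRingEnd ℂ) A * W).im := by
  have h₀ : Φ (c u) ≠ 0 := hΦ.map_ne_zero hu
  have hgu := hg.self_of_nhds
  have hopen : IsOpen (Φ.source \ {p}) := Φ.open_source.sdiff isClosed_singleton
  set k := develop (θ / (2 * Real.pi)) (Φ (c u)) with hk
  have hslit := eventually_div_mem_slitPlane h₀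
  obtain ⟨W, hW, hev⟩ := (isStraightAt_iff (by simp) (hΦ.notMem_sing hu) hgu.continuousAt
    (hΦ.isFlatMapAt hu h₀ hslit.self_of_nhds)).1 (hgu.straight (hΦ.notMem_sing hu))
  refine ⟨k (Φ (c u)), W, hW, norm_develop h₀ h₀, ?_⟩
  filter_upwards [hev.eventually_nhds, hg, hgu.continuousAt.eventually_mem (hopen.mem_nhds hu),
    ((Φ.continuousAt hu.1).comp (f := c) hgu.continuousAt).eventually hslit] with v h1 h2 h3 h4
  have hv0 := hΦ.map_ne_zero h3
  have hkv : k (Φ (c v)) = k (Φ (c u)) + (v - u) • W := h1.self_of_nhds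
  refine ⟨by rw [← hkv]; exact (norm_develop h₀ hv0).symm, ?_⟩
  obtain ⟨w, hw⟩ : ∃ w : Plane,
      w = mfderiv 𝓘(ℝ, Plane) 𝓘(ℝ, Plane) Φ (c v) (velocity c v) := ⟨_, rfl⟩
  have hmom : angularMomentum θ Φ c v =
      θ / (2 * Real.pi) * ‖Φ (c v)‖ ^ 2 * angularForm (Φ (c v)) w := by rw [hw]; rfl
  have hd0 : HasDerivAt (fun v => Φ (c v)) w v := hw ▸ hΦ.hasDerivAt_comp_curve h2 h3
  have hd1 : HasDerivAt (fun v => k (Φ (c v))) (fderiv ℝ k (Φ (c v)) w) v := ((contDiffAt_develop (θ / (2 * Real.pi)) h4).differentiableAt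
    (by simp)).hasFDerivAt.comp_hasDerivAt v hd0
  have hd2 : HasDerivAt (fun v => k (Φ (c v))) W v := by
    refine HasDerivAt.congr_of_eventuallyEq ?_ h1
    simpa using (((hasDerivAt_id v).sub_const u).smul_const W).const_add (k (Φ (c u)))
  -- Both are the velocity of the developed path: by the chain rule, and as a line. The momentum is
  -- then $\operatorname{Im}(\overline{A+(v-u)W}\,W)$, which does not depend on $v$ because
  -- $\overline W W$ is real.
  have hd3 := HasDerivAt.unique hd1 hd2
  rw [hmom, ← im_conj_develop_mul _ h₀ hv0 h4, ← hk, hd3, hkv]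
  simp
  ring

/-- Expand $|A+(v-u)W|^2$. The bound on `m` is Cauchy–Schwarz; it makes the linear term vanish when
`q = 0`. -/
theorem _root_.IsConeChart.exists_norm_sq_eq
    (hΦ : IsConeChart (X.sing : Set S) X.metric p θ R Φ)
    (hg : ∀ᶠ v in 𝓝 u, X.IsGeodesicAt q c v) (hu : c u ∈ Φ.source \ {p}) :
    ∃ m, m ^ 2 ≤ 4 * q * ‖Φ (c u)‖ ^ 2 ∧ ∀ᶠ v in 𝓝 u,
      ‖Φ (c v)‖ ^ 2 = ‖Φ (c u)‖ ^ 2 + m * (v - u) + q * (v - u) ^ 2 := by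
  obtain ⟨A, W, hW, hA, hev⟩ := hΦ.exists_developed_line hg hu
  refine ⟨2 * inner ℝ A W, ?_, ?_⟩
  · have := abs_real_inner_le_norm A W
    rw [← hW, ← hA]
    have h2 : (inner ℝ A W) ^ 2 ≤ (‖A‖ * ‖W‖) ^ 2 := sq_le_sq' (abs_le.1 this).1 (abs_le.1 this).2
    nlinarith
  · filter_upwards [hev] with v hv
    rw [hv.1, norm_add_sq_real, hA, norm_smul, mul_pow, hW, inner_smul_right, Real.norm_eq_abs,
      sq_abs]
    ring

/-- The momentum is $\operatorname{Im}(\bar A W)$, bounded by $|A||W|$. The bound tends to zero at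
the tip. -/
theorem _root_.IsConeChart.angularMomentum_eventually
    (hΦ : IsConeChart (X.sing : Set S) X.metric p θ R Φ)
    (hg : ∀ᶠ v in 𝓝 u, X.IsGeodesicAt q c v) (hu : c u ∈ Φ.source \ {p}) :
    (∀ᶠ v in 𝓝 u, angularMomentum θ Φ c v = angularMomentum θ Φ c u) ∧
      angularMomentum θ Φ c u ^ 2 ≤ q * ‖Φ (c u)‖ ^ 2 := by
  obtain ⟨A, W, hW, hA, hev⟩ := hΦ.exists_developed_line hg hu
  refine ⟨?_, ?_⟩
  · filter_upwards [hev] with v hv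
    rw [hv.2, hev.self_of_nhds.2]
  · rw [hev.self_of_nhds.2, ← hW, ← hA]
    have h1 := Complex.abs_im_le_norm ((starRingEnd ℂ) A * W)
    rw [norm_mul, RCLike.norm_conj] at h1
    have := sq_le_sq' (abs_le.1 h1).1 (abs_le.1 h1).2
    linarith

/-- A geodesic that runs into a cone point, or comes from it, has no angular momentum. -/
theorem _root_.IsConeChart.angularForm_eq_zero
    (hΦ : IsConeChart (X.sing : Set S) X.metric p θ R Φ) (hθ : 0 < θ) {a b : ℝ}
    (hg : ∀ v ∈ Ioo a b, X.IsGeodesicAt q c v) (hin : ∀ v ∈ Ioo a b, c v ∈ Φ.source \ {p})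
    {l : Filter ℝ} [l.NeBot] (hl : Ioo a b ∈ l) (hlim : Filter.Tendsto c l (𝓝 p))
    (hu : u ∈ Ioo a b) :
    angularForm (Φ (c u)) (mfderiv 𝓘(ℝ, Plane) 𝓘(ℝ, Plane) Φ (c u) (velocity c u)) = 0 := by
  have hloc := fun v hv => hΦ.angularMomentum_eventually
    (Filter.eventually_of_mem (isOpen_Ioo.mem_nhds hv) hg) (hin v hv)
  have hd : ∀ v ∈ Ioo a b, HasDerivAt (angularMomentum θ Φ c) 0 v := fun v hv =>
    (hasDerivAt_const v _).congr_of_eventuallyEq (hloc v hv).1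
  have hconst : ∀ v ∈ Ioo a b, angularMomentum θ Φ c v = angularMomentum θ Φ c u := fun v hv =>
    isOpen_Ioo.is_const_of_deriv_eq_zero (𝕜 := ℝ) isPreconnected_Ioo
      (fun z hz => (hd z hz).differentiableAt.differentiableWithinAt)
      (fun z hz => (hd z hz).deriv) hv hu
  -- The momentum is constant, and its square is at most `q * ‖Φ (c v)‖ ^ 2`, which tends to zero
  -- along `l`. Leaving `l` general covers both arrival at the tip and departure from it.
  have hle : angularMomentum θ Φ c u ^ 2 ≤ q * 0 := by
    refine ge_of_tendsto ((hΦ.tendsto_norm_sq hlim).const_mul q) ?_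
    filter_upwards [hl] with v hv
    rw [← hconst v hv]
    exact (hloc v hv).2
  have h0 : angularMomentum θ Φ c u = 0 := by
    rw [mul_zero] at hle
    exact pow_eq_zero_iff (two_ne_zero) |>.1 (le_antisymm hle (sq_nonneg _))
  have hpos := hΦ.norm_sq_pos (hin u hu)
  have hpi := Real.pi_pos
  rw [angularMomentum] at h0
  exact (mul_eq_zero.1 h0).resolve_left (by positivity)

/-- A geodesic in a cone chart that runs into the tip does not pass through the tip before. -/
theorem _root_.IsConeChart.ne_center_of_tendsto
    (hΦ : IsConeChart (X.sing : Set S) X.metric p θ R Φ) {a b : ℝ}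
    (hg : ∀ v ∈ Ioo a b, X.IsGeodesicAt q c v) (hin : ∀ v ∈ Ioo a b, c v ∈ Φ.source)
    (hlim : Filter.Tendsto c (𝓝[<] b) (𝓝 p)) (hu : u ∈ Ioo a b) : c u ≠ p := by
  intro hup
  have hclosed : ∀ v ∈ Ioo a b, ∀ w ∈ Ioo a b, IsCompact {z ∈ Icc v w | c z = p} := by
    intro v hv w hw
    have hcont : ContinuousOn c (Icc v w) := fun z hz =>
      (hg z ⟨hv.1.trans_le hz.1, hz.2.trans_lt hw.2⟩).continuousAt.continuousWithinAt
    exact isCompact_Icc.of_isClosed_subset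
      (hcont.preimage_isClosed_of_isClosed isClosed_Icc isClosed_singleton) fun z hz => hz.1
  have hiso : ∀ v ∈ Ioo a b, c v = p → ∀ᶠ z in 𝓝[≠] v, c z ≠ p := fun v hv hvp => by
    filter_upwards [(hg v hv).isolated (hvp ▸ hΦ.mem_sing)] with z hz h
    exact hz (h ▸ hΦ.mem_sing)
  obtain ⟨w, hw, hwsub⟩ := (mem_nhdsGT_iff_exists_Ioo_subset' hu.2).1
    (Filter.inter_mem ((hiso u hu hup).filter_mono (nhdsGT_le_nhdsNE u)) (Ioo_mem_nhdsGT hu.2))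
  have hw : u < w := hw
  -- `u₁` is the next time at the tip after `u`, or `b` if there is none. It exists because
  -- isolation keeps the tip away until `w` and the later visits up to a given one form a compact
  -- set.
  obtain ⟨u₁, hu₁, hu₁b, hfree, hlim₁⟩ : ∃ u₁, u < u₁ ∧ u₁ ≤ b ∧
      (∀ z ∈ Ioo u u₁, c z ≠ p) ∧ Filter.Tendsto c (𝓝[<] u₁) (𝓝 p) := by
    by_cases hex : ∃ z ∈ Ioo u b, c z = p
    · obtain ⟨z, hz, hzp⟩ := hex
      have hwz : w ≤ z := by
        by_contra! h
        exact (hwsub ⟨hz.1, h⟩).1 hzp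
      have hz' : z ∈ Ioo a b := ⟨hu.1.trans hz.1, hz.2⟩
      have hw' : w ∈ Ioo a b := ⟨hu.1.trans hw, hwz.trans_lt hz.2⟩
      obtain ⟨u₁, hmem, hleast⟩ := (hclosed w hw' z hz').exists_isLeast ⟨z, ⟨hwz, le_rfl⟩, hzp⟩
      have hu₁' : u₁ ∈ Ioo a b := ⟨hw'.1.trans_le hmem.1.1, hmem.1.2.trans_lt hz.2⟩
      refine ⟨u₁, hw.trans_le hmem.1.1, hu₁'.2.le, fun y hy hyp => ?_, ?_⟩
      · have hwy : w ≤ y := by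
          by_contra! h
          exact (hwsub ⟨hy.1, h⟩).1 hyp
        exact hy.2.not_ge (hleast ⟨⟨hwy, hy.2.le.trans hmem.1.2⟩, hyp⟩)
      · have := (hg u₁ hu₁').continuousAt.tendsto
        rw [hmem.2] at this
        exact this.mono_left nhdsWithin_le_nhds
    · push Not at hex
      exact ⟨b, hu.2, le_rfl, hex, hlim⟩
  have hsub : ∀ z ∈ Ioo u u₁, z ∈ Ioo a b := fun z hz =>
    ⟨hu.1.trans hz.1, hz.2.trans_le hu₁b⟩
  have hlim₀ : Filter.Tendsto c (𝓝[>] u) (𝓝 p) := by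
    have := (hg u hu).continuousAt.tendsto
    rw [hup] at this
    exact this.mono_left nhdsWithin_le_nhds
  have hq : 0 ≤ q := by
    obtain ⟨m, hm⟩ := nonempty_Ioo.2 hu₁
    exact ((hg m (hsub m hm)).straight
      (hΦ.notMem_sing ⟨hin m (hsub m hm), hfree m hm⟩)).nonneg
  refine quadratic_false hu₁ hq (r := fun v => ‖Φ (c v)‖ ^ 2) (fun z hz => ?_)
    (fun z hz => hΦ.norm_sq_pos ⟨hin z (hsub z hz), hfree z hz⟩)
    (hΦ.tendsto_norm_sq hlim₀) (hΦ.tendsto_norm_sq hlim₁)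
  obtain ⟨m, -, hm⟩ := hΦ.exists_norm_sq_eq
    (Filter.eventually_of_mem (isOpen_Ioo.mem_nhds (hsub z hz)) hg) ⟨hin z (hsub z hz), hfree z hz⟩
  exact ⟨m, hm⟩

/-- A geodesic that runs into a cone point has positive speed. -/
theorem _root_.IsConeChart.speed_pos_of_tendsto
    (hΦ : IsConeChart (X.sing : Set S) X.metric p θ R Φ) {a b : ℝ} (hab : a < b)
    (hg : ∀ v ∈ Ioo a b, X.IsGeodesicAt q c v) (hin : ∀ v ∈ Ioo a b, c v ∈ Φ.source \ {p})
    (hlim : Filter.Tendsto c (𝓝[<] b) (𝓝 p)) : 0 < q := by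
  obtain ⟨u, hu⟩ := nonempty_Ioo.2 hab
  have hq : 0 ≤ q := ((hg u hu).straight (hΦ.notMem_sing (hin u hu))).nonneg
  refine hq.lt_of_ne fun hq0 => ?_
  have hd : ∀ v ∈ Ioo a b, HasDerivAt (fun v => ‖Φ (c v)‖ ^ 2) 0 v := fun v hv => by
    obtain ⟨m, hm, hev⟩ := hΦ.exists_norm_sq_eq
      (Filter.eventually_of_mem (isOpen_Ioo.mem_nhds hv) hg) (hin v hv)
    rw [← hq0] at hm hev
    -- At zero speed the distance to the tip would be locally constant and positive, so it could not
    -- tend to zero.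
    have hm0 : m = 0 := by nlinarith [sq_nonneg m]
    refine (hasDerivAt_const v (‖Φ (c v)‖ ^ 2)).congr_of_eventuallyEq ?_
    filter_upwards [hev] with w hw
    rw [hw, hm0]; ring
  have hconst : ∀ v ∈ Ioo a b, ‖Φ (c v)‖ ^ 2 = ‖Φ (c u)‖ ^ 2 := fun v hv =>
    isOpen_Ioo.is_const_of_deriv_eq_zero (𝕜 := ℝ) isPreconnected_Ioo
      (fun z hz => (hd z hz).differentiableAt.differentiableWithinAt)
      (fun z hz => (hd z hz).deriv) hv hu
  have h1 : Filter.Tendsto (fun v => ‖Φ (c v)‖ ^ 2) (𝓝[<] b) (𝓝 (‖Φ (c u)‖ ^ 2)) :=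
    tendsto_const_nhds.congr' (by
      filter_upwards [Ioo_mem_nhdsLT hab] with v hv using (hconst v hv).symm)
  exact (hΦ.norm_sq_pos (hin u hu)).ne' (tendsto_nhds_unique h1 (hΦ.tendsto_norm_sq hlim))

/-- Rays from the tip of a cone are geodesics. -/
theorem _root_.IsConeChart.isGeodesicAt_ray
    (hΦ : IsConeChart (X.sing : Set S) X.metric p θ R Φ) {b : ℝ} (hq : 0 < q) {e : Plane}
    (he : ‖e‖ = 1) (hbu : b < u) (huR : √q * (u - b) < R)
    (hc : c =ᶠ[𝓝 u] fun v => Φ.symm ((√q * (v - b)) • e)) : X.IsGeodesicAt q c u := by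
  refine IsGeodesicAt.congr ?_ hc.symm
  set d : ℝ → S := fun v => Φ.symm ((√q * (v - b)) • e) with hd
  have hsq : 0 < √q := Real.sqrt_pos.2 hq
  have htgt : ∀ᶠ v in 𝓝 u, b < v ∧ (√q * (v - b)) • e ∈ Φ.target := by
    have h1 : ∀ᶠ v in 𝓝 u, √q * (v - b) < R :=
      ContinuousAt.eventually_lt (by fun_prop) continuousAt_const huR
    filter_upwards [h1, lt_mem_nhds hbu] with v hv hbv
    refine ⟨hbv, ?_⟩
    have h0 := sub_pos.2 hbv
    rw [hΦ.target_eq, mem_ball_zero_iff, norm_smul, he, mul_one, Real.norm_of_nonneg (by positivity)]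
    exact hv
  have hu0 := sub_pos.2 hbu
  have hΦd : ∀ᶠ v in 𝓝 u, Φ (d v) = (√q * (v - b)) • e :=
    htgt.mono fun v hv => Φ.right_inv hv.2
  have hpos : 0 < √q * (u - b) := by positivity
  have he0 : e ≠ 0 := by rintro rfl; simp at he
  have hne : Φ (d u) ≠ 0 := by
    rw [hΦd.self_of_nhds]; exact smul_ne_zero hpos.ne' he0
  have hmem : d u ∈ Φ.source \ {p} :=
    ⟨Φ.map_target htgt.self_of_nhds.2, fun h => hne (by rw [mem_singleton_iff.1 h, hΦ.map_center])⟩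
  have hcont : ContinuousAt d u :=
    ContinuousAt.comp (f := fun v : ℝ => (√q * (v - b)) • e)
      (Φ.continuousAt_symm htgt.self_of_nhds.2) (by fun_prop)
  refine ⟨hcont, fun hreg => ?_, fun h => (hΦ.notMem_sing hmem h).elim⟩
  refine (isStraightAt_iff (by simp) hreg hcont (hΦ.isFlatMapAt hmem hne
    (eventually_div_mem_slitPlane hne).self_of_nhds)).2 ⟨(√q : ℝ), ?_, ?_⟩
  · rw [Complex.norm_real, Real.norm_of_nonneg hsq.le, Real.sq_sqrt hq.le]
  -- Developed from its own point `Φ (d u)`, the ray runs along the positive real axis with speed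
  -- `√q`.
  · have hval : ∀ᶠ v in 𝓝 u, develop (θ / (2 * Real.pi)) (Φ (d u)) (Φ (d v)) =
        (√q * (v - b) : ℝ) := by
      filter_upwards [hΦd, htgt] with v hv hbv
      have h1 : Φ (d v) = ((v - b) / (u - b)) • Φ (d u) := by
        rw [hv, hΦd.self_of_nhds, smul_smul]; congr 1; field_simp
      have h0 := sub_pos.2 hbv.1
      rw [h1, develop_smul hne (by positivity), hΦd.self_of_nhds, norm_smul, he,
        Real.norm_of_nonneg hpos.le]
      congr 1; field_simp
    filter_upwards [hval] with v hv
    simp only [Function.comp_apply]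
    rw [hv, hval.self_of_nhds, Complex.real_smul, ← Complex.ofReal_mul, ← Complex.ofReal_add]
    congr 1; ring

/-- A geodesic that runs into a cone point continues. -/
theorem exists_continuation_of_tendsto {a b : ℝ} (hab : a < b)
    (hc : ∀ u ∈ Ioo a b, X.IsGeodesicAt q c u) (hp : p ∈ X.sing)
    (hlim : Filter.Tendsto c (𝓝[<] b) (𝓝 p)) :
    ∃ d : ℝ → S, ∃ s ∈ Ioo a b, ∃ b' > b, (∀ u ∈ Ioo s b', X.IsGeodesicAt q d u) ∧
      ∀ u ∈ Ioo s b, d u = c u := by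
  obtain ⟨R, Φ, hΦ⟩ := X.cone p hp
  have hmem : ∀ᶠ u in 𝓝[<] b, c u ∈ Φ.source :=
    hlim.eventually (Φ.open_source.mem_nhds hΦ.mem_source)
  obtain ⟨s₀, hs₀, hsub⟩ := (mem_nhdsLT_iff_exists_Ioo_subset' hab).1
    (Filter.inter_mem hmem (Ioo_mem_nhdsLT hab))
  have hs₀b : s₀ < b := hs₀
  have hg₀ : ∀ v ∈ Ioo s₀ b, X.IsGeodesicAt q c v := fun v hv => hc v (hsub hv).2
  have hin : ∀ v ∈ Ioo s₀ b, c v ∈ Φ.source \ {p} := fun v hv =>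
    ⟨(hsub hv).1, hΦ.ne_center_of_tendsto hg₀ (fun v hv => (hsub hv).1) hlim hv⟩
  have hq := hΦ.speed_pos_of_tendsto hs₀b hg₀ hin hlim
  obtain ⟨s, hs⟩ := nonempty_Ioo.2 hs₀b
  have hsq : 0 < √q := Real.sqrt_pos.2 hq
  have hR := hΦ.radius_pos
  -- Any unit vector would do: the outgoing direction at a cone point is free, so continuations are
  -- not unique.
  set e : Plane := EuclideanSpace.single 0 1 with he
  have he1 : ‖e‖ = 1 := by simp [he]
  set ray : ℝ → S := fun v => Φ.symm ((√q * (v - b)) • e) with hray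
  set d : ℝ → S := fun v => if v < b then c v else ray v with hd
  have hdb : d b = p := by
    rw [hd]; simp only [lt_irrefl, if_false, hray, sub_self, mul_zero, zero_smul]
    rw [← hΦ.map_center, Φ.left_inv hΦ.mem_source]
  have hleft : ∀ u, u < b → c =ᶠ[𝓝 u] d := fun u hu => by
    filter_upwards [gt_mem_nhds hu] with v hv
    simp [hd, hv]
  have hright : ∀ u, b < u → d =ᶠ[𝓝 u] ray := fun u hu => by
    filter_upwards [lt_mem_nhds hu] with v hv
    simp [hd, not_lt_of_gt hv]
  have hgr : ∀ u ∈ Ioo b (b + R / √q), X.IsGeodesicAt q d u := fun u hu =>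
    hΦ.isGeodesicAt_ray hq he1 hu.1 (by
      have : u - b < R / √q := by linarith [hu.2]
      rwa [lt_div_iff₀ hsq, mul_comm] at this) (hright u hu.1)
  -- `R / √q` is the time in which the ray reaches the boundary of the cone chart.
  have hRq : 0 < R / √q := by positivity
  refine ⟨d, s, (hsub hs).2, b + R / √q, by linarith, fun u hu => ?_, fun u hu => by
    simp [hd, hu.2]⟩
  rcases lt_trichotomy u b with hub | rfl | hub
  · exact (hg₀ u ⟨hs.1.trans hu.1, hub⟩).congr (hleft u hub)
  · refine ⟨?_, fun h => (h (hdb ▸ hp)).elim, fun _ => ?_⟩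
    · rw [continuousAt_iff_continuous_left'_right']
      constructor
      · rw [ContinuousWithinAt, hdb]
        refine hlim.congr' ?_
        filter_upwards [self_mem_nhdsWithin] with v hv
        simp [hd, mem_Iio.1 hv]
      · have hrc : ContinuousAt ray u := by
          refine ContinuousAt.comp (f := fun v : ℝ => (√q * (v - u)) • e)
            (Φ.continuousAt_symm ?_) (by fun_prop)
          simpa [hΦ.target_eq] using hR
        refine (hrc.continuousWithinAt (s := Ioi u)).congr (fun v hv => ?_) (by simp [hd])
        simp [hd, not_lt_of_gt (mem_Ioi.1 hv)]
    · rw [← nhdsLT_sup_nhdsGT, Filter.eventually_sup]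
      constructor
      · filter_upwards [Ioo_mem_nhdsLT hs₀b] with v hv
        have : d v = c v := by simp [hd, hv.2]
        rw [this]; exact hΦ.notMem_sing (hin v hv)
      · filter_upwards [Ioo_mem_nhdsGT (show u < u + R / √q by linarith)] with v hv
        have : d v = ray v := by simp [hd, not_lt_of_gt hv.1]
        have h0 := sub_pos.2 hv.1
        have ht : (√q * (v - u)) • e ∈ Φ.target := by
          rw [hΦ.target_eq, mem_ball_zero_iff, norm_smul, he1, mul_one,
            Real.norm_of_nonneg (by positivity), mul_comm, ← lt_div_iff₀ hsq]
          linarith [hv.2]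
        rw [this]
        refine hΦ.notMem_sing ⟨Φ.map_target ht, fun h => ?_⟩
        have h1 : Φ (ray v) = 0 := by rw [mem_singleton_iff.1 h, hΦ.map_center]
        rw [hray, Φ.right_inv ht] at h1
        have h2 := congrArg norm h1
        rw [norm_smul, he1, mul_one, norm_zero, norm_eq_zero] at h2
        exact (mul_pos hsq h0).ne' h2
  · exact hgr u ⟨hub, hu.2⟩

end ConeSurface

/-! ### Extension to the whole real line -/

namespace ConeSurface

variable {S : Type*} [TopologicalSpace S] [ChartedSpace Plane S] {X : ConeSurface S}
  [IsManifold 𝓘(ℝ, Plane) ∞ S] [T2Space S] [CompactSpace S] {q : ℝ} {c : ℝ → S} {I : Set ℝ}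

/-- A geodesic defined on an open interval that is bounded above extends to a larger one. -/
theorem exists_larger_of_lt (hI : IsOpenInterval I) (hc : ∀ u ∈ I, X.IsGeodesicAt q c u) {a b : ℝ}
    (ha : a ∈ I) (hb : b ∉ I) (hab : a < b) :
    ∃ (J : Set ℝ) (d : ℝ → S), IsOpenInterval J ∧ I ⊂ J ∧ (∀ u ∈ J, X.IsGeodesicAt q d u) ∧
      EqOn d c I := by
  have hlt : ∀ u ∈ I, u < b := fun u hu => by
    by_contra! h
    exact hb (hI.2.1.out ha hu ⟨hab.le, h⟩)
  have hbdd : BddAbove I := ⟨b, fun u hu => (hlt u hu).le⟩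
  set β := sSup I with hβ
  have hβI : β ∉ I := fun h => by
    obtain ⟨ε, hε, hsub⟩ := Metric.isOpen_iff.1 hI.1 β h
    have h1 : β + ε / 2 ∈ I := hsub (by
      rw [Metric.mem_ball, Real.dist_eq, add_sub_cancel_left, abs_of_pos (by positivity)]; linarith)
    linarith [le_csSup hbdd h1]
  have hIβ : ∀ u ∈ I, u < β := fun u hu =>
    (le_csSup hbdd hu).lt_of_ne fun h => hβI (by rw [hβ, ← h]; exact hu)
  have haβ := hIβ a ha
  have hsub : Ioo a β ⊆ I := fun u hu => by
    obtain ⟨v, hv, huv⟩ := exists_lt_of_lt_csSup ⟨a, ha⟩ hu.2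
    exact hI.2.1.out ha hv ⟨hu.1.le, huv.le⟩
  obtain ⟨d, s, hs, b', hb', hd, hdc⟩ : ∃ d : ℝ → S, ∃ s ∈ Ioo a β, ∃ b' > β,
      (∀ u ∈ Ioo s b', X.IsGeodesicAt q d u) ∧ ∀ u ∈ Ioo s β, d u = c u := by
    have hg : ∀ u ∈ Ioo a β, X.IsGeodesicAt q c u := fun u hu => hc u (hsub hu)
    rcases exists_clusterPt_or_tendsto haβ
      (fun u hu => (hg u hu).continuousAt.continuousWithinAt) X.sing with
      ⟨x, hx, hcl⟩ | ⟨p, hp, hlim⟩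
    · exact exists_continuation_of_clusterPt haβ hg hx hcl
    · exact exists_continuation_of_tendsto haβ hg hp hlim
  -- The two paths agree on `Ioo s β`, so near every time of either interval `e` coincides with a
  -- geodesic.
  set e : ℝ → S := fun u => if u < β then c u else d u with he
  have hec : ∀ u ∈ I, c =ᶠ[𝓝 u] e := fun u hu => by
    filter_upwards [gt_mem_nhds (hIβ u hu)] with v hv
    simp [he, hv]
  have hed : ∀ u ∈ Ioo s b', d =ᶠ[𝓝 u] e := fun u hu => by
    filter_upwards [isOpen_Ioo.mem_nhds hu] with v hv
    by_cases h : v < β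
    · simp [he, h, hdc v ⟨hv.1, h⟩]
    · simp [he, h]
  obtain ⟨m, hm⟩ := nonempty_Ioo.2 hs.2
  refine ⟨I ∪ Ioo s b', e, ⟨hI.1.union isOpen_Ioo, ?_, hI.2.2.mono subset_union_left⟩, ?_, ?_,
    fun u hu => (hec u hu).self_of_nhds.symm⟩
  · exact (IsPreconnected.union m (hsub ⟨hs.1.trans hm.1, hm.2⟩) (show m ∈ Ioo s b' from ⟨hm.1, hm.2.trans hb'⟩)
      hI.2.1.isPreconnected isPreconnected_Ioo).ordConnected
  · exact (ssubset_iff_of_subset subset_union_left).2 ⟨β, Or.inr ⟨hs.2, hb'⟩, hβI⟩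
  · rintro u (hu | hu)
    · exact (hc u hu).congr (hec u hu)
    · exact (hd u hu).congr (hed u hu)

theorem exists_larger (hI : IsOpenInterval I) (hc : ∀ u ∈ I, X.IsGeodesicAt q c u)
    (hne : I ≠ univ) :
    ∃ (J : Set ℝ) (d : ℝ → S), IsOpenInterval J ∧ I ⊂ J ∧ (∀ u ∈ J, X.IsGeodesicAt q d u) ∧
      EqOn d c I := by
  obtain ⟨b, hb⟩ := (ne_univ_iff_exists_notMem I).1 hne
  obtain ⟨a, ha⟩ := hI.2.2
  rcases lt_trichotomy a b with hab | rfl | hab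
  · exact exists_larger_of_lt hI hc ha hb hab
  · exact (hb ha).elim
  · have hneg : ∀ {K : Set ℝ}, IsOpenInterval K → IsOpenInterval (-K) := fun {K} hK =>
      ⟨hK.1.neg, ⟨fun x hx y hy z hz => hK.2.1.out hy hx ⟨neg_le_neg hz.2, neg_le_neg hz.1⟩⟩,
        hK.2.2.neg⟩
    obtain ⟨J, d, hJ, hIJ, hd, hdc⟩ := exists_larger_of_lt (c := fun u => c (-u)) (a := -a)
      (b := -b) (hneg hI) (fun u hu => by simpa using (hc (-u) hu).comp_neg) (by simpa using ha)
      (by simpa using hb) (neg_lt_neg hab)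
    refine ⟨-J, fun u => d (-u), hneg hJ, ?_, fun u hu => by simpa using (hd (-u) hu).comp_neg,
      fun u hu => ?_⟩
    · refine ⟨fun u hu => hIJ.1 (by simpa using hu), fun h => hIJ.2 fun u hu => ?_⟩
      have : -u ∈ I := h (by simpa using hu)
      simpa using this
    · have : d (-u) = c (- -u) := hdc (show -u ∈ -I by simpa using hu)
      simpa using this

/-- Geodesics of a closed cone surface extend to the whole real line. -/
theorem exists_extension (hI : IsOpenInterval I) (hc : ∀ u ∈ I, X.IsGeodesicAt q c u) :
    ∃ d : ℝ → S, (∀ u, X.IsGeodesicAt q d u) ∧ EqOn d c I := by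
  -- Extensions through cone points involve choices, so two of them need not be compatible; Zorn's
  -- lemma picks a maximal one under the restriction order.
  let Ext := {P : Set ℝ × (ℝ → S) // IsOpenInterval P.1 ∧ I ⊆ P.1 ∧
    (∀ u ∈ P.1, X.IsGeodesicAt q P.2 u) ∧ EqOn P.2 c I}
  let r : Ext → Ext → Prop := fun P Q => P.1.1 ⊆ Q.1.1 ∧ EqOn Q.1.2 P.1.2 P.1.1
  have hne : Nonempty Ext := ⟨⟨(I, c), hI, subset_rfl, hc, fun _ _ => rfl⟩⟩
  obtain ⟨⟨⟨J, d⟩, hJ, hIJ, hd, hdc⟩, hmax⟩ : ∃ m : Ext, ∀ P, r m P → r P m := by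
    refine exists_maximal_of_nonempty_chains_bounded (r := r) (fun C hC hCne => ?_)
      (fun {P Q R} h1 h2 => ⟨h1.1.trans h2.1, fun u hu => (h2.2 (h1.1 hu)).trans (h1.2 hu)⟩)
    have hcompat : ∀ P ∈ C, ∀ Q ∈ C, ∀ u ∈ P.1.1, u ∈ Q.1.1 → P.1.2 u = Q.1.2 u := by
      intro P hP Q hQ u huP huQ
      rcases eq_or_ne P Q with rfl | hPQ
      · rfl
      rcases hC hP hQ hPQ with h | h
      · exact (h.2 huP).symm
      · exact h.2 huQ
    obtain ⟨P₀, hP₀⟩ := hCne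
    set U : Set ℝ := ⋃ P ∈ C, P.1.1 with hU
    have hex : ∀ u ∈ U, ∃ P ∈ C, u ∈ P.1.1 := fun u hu => by simpa [hU] using hu
    classical
    let e : ℝ → S := fun u => if h : u ∈ U then (hex u h).choose.1.2 u else c u
    have he : ∀ P ∈ C, EqOn e P.1.2 P.1.1 := by
      intro P hP u hu
      have huU : u ∈ U := mem_biUnion hP hu
      have : e u = (hex u huU).choose.1.2 u := dif_pos huU
      rw [this]
      exact hcompat _ (hex u huU).choose_spec.1 P hP u (hex u huU).choose_spec.2 hu
    obtain ⟨a, ha⟩ := hI.2.2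
    refine ⟨⟨(U, e), ⟨isOpen_biUnion fun P _ => P.2.1.1, ?_, ?_⟩, ?_, ?_, ?_⟩, fun P hP => ?_⟩
    · have h1 := isPreconnected_sUnion a ((fun P : Ext => P.1.1) '' C)
        (by rintro _ ⟨P, -, rfl⟩; exact P.2.2.1 ha)
        (by rintro _ ⟨P, -, rfl⟩; exact P.2.1.2.1.isPreconnected)
      rw [sUnion_image] at h1
      exact h1.ordConnected
    · exact P₀.2.1.2.2.mono (subset_biUnion_of_mem (u := fun P : Ext => P.1.1) hP₀)
    · exact P₀.2.2.1.trans (subset_biUnion_of_mem (u := fun P : Ext => P.1.1) hP₀)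
    · intro u hu
      obtain ⟨P, hP, huP⟩ := hex u hu
      exact (P.2.2.2.1 u huP).congr
        (Filter.eventuallyEq_of_mem (P.2.1.1.mem_nhds huP) (he P hP)).symm
    · exact fun u hu => (he P₀ hP₀ (P₀.2.2.1 hu)).trans (P₀.2.2.2.2 hu)
    · exact ⟨subset_biUnion_of_mem (u := fun P : Ext => P.1.1) hP, he P hP⟩
  have hJu : J = univ := by
    by_contra hne
    obtain ⟨K, e, hK, hJK, he, hed⟩ := exists_larger hJ hd hne
    exact hJK.2 (hmax ⟨(K, e), hK, hIJ.trans hJK.1, he,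
      fun u hu => (hed (hIJ hu)).trans (hdc hu)⟩ ⟨hJK.1, hed⟩).1
  exact ⟨d, fun u => hd u (by simp only [hJu, mem_univ]), hdc⟩

end ConeSurface

/-! ### The time coordinate along a surface geodesic -/

namespace ConeSurface

variable {S : Type*} [TopologicalSpace S] [ChartedSpace Plane S] {X : ConeSurface S}
  {q l : ℝ} {c d : ℝ → S} {I : Set ℝ} {s : ℝ}
  {η : CovectorField S} {f : S → ℝ} {T : ℝ → ℝ}

theorem IsGeodesicAt.eventually_regular (h : X.IsGeodesicAt q c s) [T1Space S]
    (hreg : c s ∉ X.sing) : ∀ᶠ u in 𝓝 s, c u ∉ X.sing :=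
  h.continuousAt.eventually_mem (X.sing.finite_toSet.isClosed.isOpen_compl.mem_nhds hreg)

/-- Singular times are isolated, and discrete subsets of the line are countable. They are thus
negligible in integrals and allowed as exceptions in the fundamental theorem of calculus. -/
theorem countable_singular_times (hc : ∀ u ∈ I, X.IsGeodesicAt q c u) :
    {u ∈ I | c u ∈ X.sing}.Countable := by
  refine (HereditarilyLindelofSpace.isLindelof _).countable_of_isDiscrete
    (isDiscrete_iff_nhdsNE.2 fun u hu => ?_)
  refine disjoint_iff.1 (Filter.disjoint_principal_right.2 ?_)
  filter_upwards [(hc u hu.1).isolated hu.2] with v hv h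
  exact hv h.2

theorem continuousAt_deriv_gauge [T1Space S] (hf : X.IsGauge η f) (h : X.IsGeodesicAt q c s)
    (hreg : c s ∉ X.sing) : ContinuousAt (deriv fun u => f (c u)) s := by
  obtain ⟨φ, hφ, hsφ, V, -, hev⟩ := h.straight hreg
  have hsx : φ.symm (φ (c s)) = c s := φ.left_inv hsφ
  have hcd : ContDiffAt ℝ ∞ (f ∘ φ.symm) (φ (c s)) := by
    rw [← contMDiffAt_iff_contDiffAt]
    refine ContMDiffAt.comp (I' := 𝓘(ℝ, Plane)) _ ?_
      ((contMDiffOn_symm_of_mem_maximalAtlas hφ.1.1).contMDiffAt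
        (φ.open_target.mem_nhds (φ.map_source hsφ)))
    rw [hsx]
    exact hf.1.contMDiffAt (X.sing.finite_toSet.isClosed.isOpen_compl.mem_nhds hreg)
  have hline : ContDiffAt ℝ ∞ (fun u : ℝ => φ (c s) + (u - s) • V) s := by fun_prop
  have hg : ContDiffAt ℝ ∞ ((f ∘ φ.symm) ∘ fun u : ℝ => φ (c s) + (u - s) • V) s :=
    ContDiffAt.comp s (by simpa using hcd) hline
  have heq : (fun u => f (c u)) =ᶠ[𝓝 s] (f ∘ φ.symm) ∘ fun u : ℝ => φ (c s) + (u - s) • V := by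
    filter_upwards [hev, h.continuousAt.eventually_mem (φ.open_source.mem_nhds hsφ)] with u h1 h2
    simp only [Function.comp_apply]
    rw [← h1, φ.left_inv h2]
  have hg' := hg.congr_of_eventuallyEq heq
  have h3 : ContinuousAt (fderiv ℝ fun u => f (c u)) s :=
    (hg'.fderiv_right (m := 0) (by simp)).continuousAt
  exact h3.clm_apply (continuousAt_const (y := (1 : ℝ)))

variable [IsManifold 𝓘(ℝ, Plane) ∞ S]

theorem IsGeodesicAt.covector_velocity_congr (h : X.IsGeodesicAt q c s) (hcd : c =ᶠ[𝓝 s] d)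
    (hreg : c s ∉ X.sing) (η : CovectorField S) :
    η (c s) (velocity c s) = η (d s) (velocity d s) := by
  obtain ⟨φ, hφ, hsφ, V, -, hev⟩ := h.straight hreg
  have hV := (hasDerivAt_of_eventually_line hev).self_of_nhds
  have hs : c s = d s := hcd.self_of_nhds
  rw [covector_velocity hφ.1.mdifferentiable h.continuousAt hsφ hV,
    covector_velocity hφ.1.mdifferentiable (h.continuousAt.congr hcd) (hs ▸ hsφ)
      (hV.congr_of_eventuallyEq (hcd.mono fun u hu => congrArg φ hu.symm)), hs]

theorem continuousAt_form (hη : X.IsClosedForm η) (h : ∀ᶠ u in 𝓝 s, X.IsGeodesicAt q c u)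
    (hreg : c s ∉ X.sing) : ContinuousAt (fun u => η (c u) (velocity c u)) s := by
  have hs := h.self_of_nhds
  obtain ⟨φ, hφ, hsφ, V, -, hev⟩ := hs.straight hreg
  have hev' : (fun u => η (c u) (velocity c u)) =ᶠ[𝓝 s]
      fun u => covectorInChart η φ (φ (c u)) V := by
    filter_upwards [h, hasDerivAt_of_eventually_line hev,
      hs.continuousAt.eventually_mem (φ.open_source.mem_nhds hsφ)] with u h1 h2 h3
    exact covector_velocity hφ.1.mdifferentiable h1.continuousAt h3 h2 η
  refine ContinuousAt.congr ?_ hev'.symm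
  have h1 : ContinuousAt (covectorInChart η φ) (φ (c s)) :=
    (hη φ hφ.1).1.continuousOn.continuousAt (φ.open_target.mem_nhds (φ.map_source hsφ))
  have h2 : ContinuousAt (fun u => φ (c u)) s := (φ.continuousAt hsφ).comp hs.continuousAt
  exact (ContinuousAt.comp (f := fun u => φ (c u)) h1 h2).clm_apply continuousAt_const

theorem hasDerivAt_gauge [T1Space S] (hf : X.IsGauge η f) (h : X.IsGeodesicAt q c s)
    (hreg : c s ∉ X.sing) :
    HasDerivAt (fun u => f (c u)) (η (c s) (velocity c s) - gaugedForm η f (c s) (velocity c s))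
      s := by
  obtain ⟨φ, hφ, hsφ, V, -, hev⟩ := h.straight hreg
  have hfd : MDifferentiableAt 𝓘(ℝ, Plane) 𝓘(ℝ, ℝ) f (c s) :=
    (hf.1.contMDiffAt (X.sing.finite_toSet.isClosed.isOpen_compl.mem_nhds hreg)).mdifferentiableAt
      (by simp)
  obtain ⟨D, hD⟩ : ∃ D : Plane →L[ℝ] ℝ, D = mfderiv 𝓘(ℝ, Plane) 𝓘(ℝ, ℝ) f (c s) := ⟨_, rfl⟩
  have h1 := hasDerivAt_comp_curve hφ.1.mdifferentiable h.continuousAt hsφ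
    (hasDerivAt_of_eventually_line hev).self_of_nhds (hD ▸ hfd.hasMFDerivAt)
  have h2 : gaugedForm η f (c s) (velocity c s) =
      η (c s) (velocity c s) - D (velocity c s) := by rw [hD]; rfl
  exact h1.congr_deriv (by rw [h2]; ring)

open MeasureTheory in
theorem time_eq_of_hasDerivAt (hη : X.IsClosedForm η) (hI : IsOpenInterval I)
    (hc : ∀ u ∈ I, X.IsGeodesicAt q c u)
    (hT : ∀ u ∈ I, c u ∉ X.sing → HasDerivAt T (l - η (c u) (velocity c u)) u) {a : ℝ}
    (ha : a ∈ I) (hs : s ∈ I) (hreg : ∀ u ∈ uIcc a s, c u ∉ X.sing) :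
    IntervalIntegrable (fun u => η (c u) (velocity c u)) volume a s ∧
      T s = T a + l * (s - a) - ∫ u in a..s, η (c u) (velocity c u) := by
  have hsub : uIcc a s ⊆ I := hI.2.1.uIcc_subset ha hs
  have hint : IntervalIntegrable (fun u => η (c u) (velocity c u)) volume a s :=
    ContinuousOn.intervalIntegrable fun u hu => (continuousAt_form hη
      (Filter.eventually_of_mem (hI.1.mem_nhds (hsub hu)) hc) (hreg u hu)).continuousWithinAt
  refine ⟨hint, ?_⟩
  have h1 := intervalIntegral.integral_eq_sub_of_hasDerivAt
    (fun u hu => hT u (hsub hu) (hreg u hu)) (intervalIntegrable_const.sub hint)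
  rw [intervalIntegral.integral_sub intervalIntegrable_const hint,
    intervalIntegral.integral_const, smul_eq_mul] at h1
  linarith

variable [T2Space S]

/-- On either side of a singular time the geodesic is radial, so $d\alpha$ vanishes on its velocity;
the value of $\sigma$ plays no role. -/
theorem gaugedForm_velocity_eventually (hf : X.IsGauge η f)
    (h : ∀ᶠ u in 𝓝 s, X.IsGeodesicAt q c u) (hsing : c s ∈ X.sing) :
    ∀ᶠ u in 𝓝[≠] s, gaugedForm η f (c u) (velocity c u) = 0 := by
  obtain ⟨σ, R, Φ, hΦ, hform⟩ := hf.2 _ hsing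
  have hs := h.self_of_nhds
  have hcont := hs.continuousAt
  have hev : ∀ᶠ u in 𝓝[≠] s, X.IsGeodesicAt q c u ∧ c u ∈ Φ.source \ {c s} := by
    filter_upwards [h.filter_mono nhdsWithin_le_nhds, hs.isolated hsing,
      (hcont.eventually_mem (Φ.open_source.mem_nhds hΦ.mem_source)).filter_mono
        nhdsWithin_le_nhds] with u h1 h2 h3
    exact ⟨h1, h3, fun h4 => h2 (by rw [mem_singleton_iff.1 h4]; exact hsing)⟩
  have hθ := X.angle_pos _ hsing
  rw [← nhdsLT_sup_nhdsGT, Filter.eventually_sup] at hev ⊢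
  constructor
  · obtain ⟨a, ha, hsub⟩ := (mem_nhdsLT_iff_exists_Ioo_subset' (sub_one_lt s)).1 hev.1
    filter_upwards [Ioo_mem_nhdsLT ha] with u hu
    rw [hform _ (hsub hu).2, hΦ.angularForm_eq_zero hθ (fun v hv => (hsub hv).1)
      (fun v hv => (hsub hv).2) (Ioo_mem_nhdsLT ha)
      (hcont.tendsto.mono_left nhdsWithin_le_nhds) hu, mul_zero]
  · obtain ⟨a, ha, hsub⟩ := (mem_nhdsGT_iff_exists_Ioo_subset' (lt_add_one s)).1 hev.2
    filter_upwards [Ioo_mem_nhdsGT ha] with u hu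
    rw [hform _ (hsub hu).2, hΦ.angularForm_eq_zero hθ (fun v hv => (hsub hv).1)
      (fun v hv => (hsub hv).2) (Ioo_mem_nhdsGT ha)
      (hcont.tendsto.mono_left nhdsWithin_le_nhds) hu, mul_zero]

/-- Along a geodesic the gauged form, set to zero at the singular times, is continuous. -/
theorem exists_continuousOn_gaugedForm (hη : X.IsClosedForm η) (hf : X.IsGauge η f)
    (hI : IsOpen I) (hc : ∀ u ∈ I, X.IsGeodesicAt q c u) :
    ∃ k : ℝ → ℝ, ContinuousOn k I ∧
      ∀ u ∈ I, c u ∉ X.sing → gaugedForm η f (c u) (velocity c u) = k u := by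
  classical
  set k : ℝ → ℝ := fun u => if c u ∈ X.sing then 0 else gaugedForm η f (c u) (velocity c u) with hk
  refine ⟨k, fun u hu => ContinuousAt.continuousWithinAt ?_, fun u hu hreg => by simp [hk, hreg]⟩
  have hev : ∀ᶠ v in 𝓝 u, X.IsGeodesicAt q c v := Filter.eventually_of_mem (hI.mem_nhds hu) hc
  by_cases hsing : c u ∈ X.sing
  · refine (continuousAt_const (y := (0 : ℝ))).congr ?_
    have h1 := gaugedForm_velocity_eventually hf hev hsing
    rw [eventually_nhdsWithin_iff] at h1
    filter_upwards [h1] with v hv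
    by_cases hvu : v = u
    · simp [hk, hvu, hsing]
    · simp [hk, hv hvu]
  · have h1 := (hc u hu).eventually_regular hsing
    refine ((continuousAt_form hη hev hsing).sub
      (continuousAt_deriv_gauge hf (hc u hu) hsing)).congr ?_
    filter_upwards [h1, hev] with v hv hgv
    simp only [hk, hv, if_false, Pi.sub_apply]
    rw [(hasDerivAt_gauge (η := η) hf hgv hv).deriv, sub_sub_cancel]

open MeasureTheory in
-- At singular times the value of the form is arbitrary and the velocity may be a default value.
-- Replacing the integrand there by a continuous `k` changes it on a countable set only.
theorem intervalIntegrable_gaugedForm (hη : X.IsClosedForm η) (hf : X.IsGauge η f)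
    (hI : IsOpenInterval I) (hc : ∀ u ∈ I, X.IsGeodesicAt q c u) :
    ∃ k : ℝ → ℝ, ContinuousOn k I ∧
      (∀ u ∈ I, c u ∉ X.sing → gaugedForm η f (c u) (velocity c u) = k u) ∧
      ∀ a ∈ I, ∀ s ∈ I, IntervalIntegrable k volume a s ∧
        IntervalIntegrable (fun u => gaugedForm η f (c u) (velocity c u)) volume a s ∧
        ∫ u in a..s, gaugedForm η f (c u) (velocity c u) = ∫ u in a..s, k u := by
  obtain ⟨k, hk, hkeq⟩ := exists_continuousOn_gaugedForm hη hf hI.1 hc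
  refine ⟨k, hk, hkeq, fun a ha s hs => ?_⟩
  have hsub : uIcc a s ⊆ I := hI.2.1.uIcc_subset ha hs
  have hint : IntervalIntegrable k volume a s := (hk.mono hsub).intervalIntegrable
  have hae : ∀ᵐ u, u ∈ uIoc a s → k u = gaugedForm η f (c u) (velocity c u) := by
    have h1 : ∀ᵐ u, u ∉ {u ∈ I | c u ∈ X.sing} :=
      (countable_singular_times hc).ae_notMem volume
    filter_upwards [h1] with u hu hus
    have huI := hsub (uIoc_subset_uIcc hus)
    exact (hkeq u huI fun h => hu ⟨huI, h⟩).symm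
  refine ⟨hint, hint.congr_ae ((ae_restrict_iff' measurableSet_uIoc).2 hae), ?_⟩
  exact (intervalIntegral.integral_congr_ae hae).symm

open MeasureTheory in
-- `T + f ∘ c` is continuous with derivative `l - k` off the countable set of singular times, which
-- suffices for the fundamental theorem of calculus.
theorem height_eq_of_hasDerivAt (hη : X.IsClosedForm η) (hf : X.IsGauge η f)
    (hI : IsOpenInterval I) (hc : ∀ u ∈ I, X.IsGeodesicAt q c u)
    (hT : ∀ u ∈ I, c u ∉ X.sing → HasDerivAt T (l - η (c u) (velocity c u)) u)
    (hcont : ContinuousOn (fun u => T u + f (c u)) I) {a : ℝ} (ha : a ∈ I) (hs : s ∈ I) :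
    T s + f (c s) = T a + f (c a) + l * (s - a)
      - ∫ u in a..s, gaugedForm η f (c u) (velocity c u) := by
  obtain ⟨k, hk, hkeq, hint⟩ := intervalIntegrable_gaugedForm hη hf hI hc
  have hsub : uIcc a s ⊆ I := hI.2.1.uIcc_subset ha hs
  obtain ⟨h1, -, h3⟩ := hint a ha s hs
  have h4 := integral_eq_of_hasDerivAt_off_countable (fun u => T u + f (c u)) (fun u => l - k u)
    (countable_singular_times hc) (hcont.mono hsub) (fun u hu => by
      have huI : u ∈ I := hsub (Ioo_subset_Icc_self hu.1)
      have hreg : c u ∉ X.sing := fun h => hu.2 ⟨huI, h⟩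
      have := (hT u huI hreg).fun_add (hasDerivAt_gauge hf (hc u huI) hreg)
      rw [hkeq u huI hreg] at this
      exact this.congr_deriv (by ring)) (intervalIntegrable_const.sub h1)
  rw [intervalIntegral.integral_sub intervalIntegrable_const h1,
    intervalIntegral.integral_const, smul_eq_mul] at h4
  rw [h3]
  linarith

open MeasureTheory in
-- As `k` is continuous, the formula makes `T + f ∘ c` differentiable at every time, singular ones
-- included. Subtracting the derivative of `f ∘ c` at regular times gives that of `T`.
theorem hasDerivAt_of_height_eq (hη : X.IsClosedForm η) (hf : X.IsGauge η f)
    (hI : IsOpenInterval I) (hc : ∀ u ∈ I, X.IsGeodesicAt q c u)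
    (h : ∀ a ∈ I, ∀ s ∈ I, T s + f (c s) = T a + f (c a) + l * (s - a)
      - ∫ u in a..s, gaugedForm η f (c u) (velocity c u)) :
    (∀ u ∈ I, c u ∉ X.sing → HasDerivAt T (l - η (c u) (velocity c u)) u) ∧
      ContinuousOn (fun u => T u + f (c u)) I := by
  obtain ⟨k, hk, hkeq, hint⟩ := intervalIntegrable_gaugedForm hη hf hI hc
  have hd : ∀ u ∈ I, HasDerivAt (fun u => T u + f (c u)) (l - k u) u := by
    intro u hu
    have h1 : HasDerivAt (fun s => ∫ v in u..s, k v) (k u) u :=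
      intervalIntegral.integral_hasDerivAt_right (hint u hu u hu).1
        (hk.stronglyMeasurableAtFilter hI.1 u hu) (hk.continuousAt (hI.1.mem_nhds hu))
    have h2 : HasDerivAt (fun s => T u + f (c u) + l * (s - u) - ∫ v in u..s, k v) (l - k u) u := by
      simpa using ((((hasDerivAt_id u).sub_const u).const_mul l).const_add (T u + f (c u))).fun_sub h1
    refine h2.congr_of_eventuallyEq ?_
    filter_upwards [hI.1.mem_nhds hu] with s hs
    rw [h u hu s hs, (hint u hu s hs).2.2]
  refine ⟨fun u hu hreg => ?_, fun u hu => (hd u hu).continuousAt.continuousWithinAt⟩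
  have h1 := (hd u hu).fun_sub (hasDerivAt_gauge hf (hc u hu) hreg)
  rw [hkeq u hu hreg] at h1
  simp only [add_sub_cancel_right] at h1
  exact h1.congr_deriv (by ring)

end ConeSurface

/-! ### Geodesics of the spacetime -/

namespace ConeSurface

variable {S : Type*} [TopologicalSpace S] [ChartedSpace Plane S] {X : ConeSurface S}
  {q l : ℝ} {c : ℝ → S} {I : Set ℝ} {s : ℝ}
  {η : CovectorField S} {f : S → ℝ} {T : ℝ → ℝ}

theorem integral_form_const (hI : IsOpenInterval I) {p : S} (h : ∀ s ∈ I, c s = p)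
    (ζ : CovectorField S) {a : ℝ} (ha : a ∈ I) (hs : s ∈ I) :
    IntervalIntegrable (fun u => ζ (c u) (velocity c u)) MeasureTheory.volume a s ∧
      ∫ u in a..s, ζ (c u) (velocity c u) = 0 := by
  have hsub : uIcc a s ⊆ I := hI.2.1.uIcc_subset ha hs
  have h0 : ∀ u ∈ I, ζ (c u) (velocity c u) = 0 := fun u hu => by
    have heq : c =ᶠ[𝓝 u] fun _ => p := Filter.eventually_of_mem (hI.1.mem_nhds hu) h
    have hd : HasMFDerivAt 𝓘(ℝ, ℝ) 𝓘(ℝ, Plane) c u (0 : ℝ →L[ℝ] Plane) :=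
      (hasMFDerivAt_const p u).congr_of_eventuallyEq heq
    have hv : velocity c u = (0 : Plane) := by rw [velocity, hd.mfderiv]; rfl
    rw [hv]
    exact map_zero (ζ (c u))
  constructor
  · refine (intervalIntegrable_const (c := (0 : ℝ))).congr fun u hu => ?_
    exact (h0 u (hsub (uIoc_subset_uIcc hu))).symm
  · rw [intervalIntegral.integral_congr fun u hu => h0 u (hsub hu)]
    simp

variable [IsManifold 𝓘(ℝ, Plane) ∞ S]

theorem stationaryMetricInChart_eq {P : Set S} {g : BilinField S}
    {φ : OpenPartialHomeomorph S Plane} (hφ : IsFlatChart P g φ) (η : CovectorField S)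
    {z : Plane × ℝ} (hz : z.1 ∈ φ.target) (V W : Plane × ℝ) :
    stationaryMetricInChart g η φ z V W = inner ℝ V.1 W.1
      - (covectorInChart η φ z.1 V.1 + V.2) * (covectorInChart η φ z.1 W.1 + W.2) := by
  rw [← hφ.metricInChart_eq hz]; rfl

theorem fderiv_stationaryMetricInChart {P : Set S} {g : BilinField S}
    {φ : OpenPartialHomeomorph S Plane} (hφ : IsFlatChart P g φ)
    (hη : IsClosedFormOff P η) {z : Plane × ℝ} (hz : z.1 ∈ φ.target) (V w : Plane × ℝ) :
    fderiv ℝ (fun y => stationaryMetricInChart g η φ y V V) z w =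
      -(2 * (covectorInChart η φ z.1 V.1 + V.2) *
        fderiv ℝ (covectorInChart η φ) z.1 w.1 V.1) := by
  have hβ : HasFDerivAt (covectorInChart η φ) (fderiv ℝ (covectorInChart η φ) z.1) z.1 :=
    (((hη φ hφ.1).1.contDiffAt (φ.open_target.mem_nhds hz)).differentiableAt
      (by simp)).hasFDerivAt
  have h1 : HasFDerivAt (fun y : Plane × ℝ => covectorInChart η φ y.1)
      ((fderiv ℝ (covectorInChart η φ) z.1).comp (ContinuousLinearMap.fst ℝ Plane ℝ)) z :=
    HasFDerivAt.comp (f := Prod.fst) z hβ hasFDerivAt_fst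
  have h2 := (h1.clm_apply (hasFDerivAt_const V.1 z)).add_const V.2
  have h3 := ((h2.mul h2).const_sub (inner ℝ V.1 V.1 : ℝ))
  have heq : (fun y => stationaryMetricInChart g η φ y V V) =ᶠ[𝓝 z] fun y : Plane × ℝ =>
      inner ℝ V.1 V.1 - (covectorInChart η φ y.1 V.1 + V.2)
        * (covectorInChart η φ y.1 V.1 + V.2) := by
    filter_upwards [continuousAt_fst.eventually_mem (φ.open_target.mem_nhds hz)] with y hy
    exact stationaryMetricInChart_eq hφ η hy V V
  have h4 := congrArg (fun D : Plane × ℝ →L[ℝ] ℝ => D w) (heq.fderiv_eq.trans h3.fderiv)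
  refine h4.trans ?_
  simp
  ring

theorem hasDerivAt_clm_comp_apply {E : Type*} [NormedAddCommGroup E] [NormedSpace ℝ E]
    {β : E → E →L[ℝ] ℝ} {D : E →L[ℝ] E →L[ℝ] ℝ} {γ : ℝ → E} {v : E}
    (hβ : HasFDerivAt β D (γ s)) (hγ : HasDerivAt γ v s) (w : E) (r : ℝ) :
    HasDerivAt (fun u => β (γ u) w + r) (D v w) s := by
  have h1 : HasDerivAt (fun u => β (γ u)) (D v) s := hβ.comp_hasDerivAt s hγ
  simpa using (h1.clm_apply (hasDerivAt_const s w)).add_const r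

/-- In a flat chart the geodesic equation of the stationary metric says that the projection to the
surface is a line and that the momentum with respect to the Killing field `∂_t` is conserved. -/
theorem solvesGeodesicEq_stationaryMetric_iff (hη : X.IsClosedForm η)
    {φ : OpenPartialHomeomorph S Plane} (hφ : IsFlatChart (X.sing : Set S) X.metric φ)
    (hc : ContinuousAt c s) (hs : c s ∈ φ.source) :
    SolvesGeodesicEq (stationaryMetricInChart X.metric η φ)
        (fun u => ((φ (c u), T u) : Plane × ℝ)) s ↔
      ∃ (V : ℝ → Plane) (τ : ℝ → ℝ), (∀ᶠ u in 𝓝 s, HasDerivAt (fun u => φ (c u)) (V u) u) ∧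
        (∀ᶠ u in 𝓝 s, HasDerivAt T (τ u) u) ∧ HasDerivAt V 0 s ∧
        HasDerivAt (fun u => covectorInChart η φ (φ (c u)) (V u) + τ u) 0 s := by
  have htgt := φ.map_source hs
  have hβ : HasFDerivAt (covectorInChart η φ) (fderiv ℝ (covectorInChart η φ) (φ (c s)))
      (φ (c s)) :=
    (((hη φ hφ.1).1.contDiffAt (φ.open_target.mem_nhds htgt)).differentiableAt
      (by simp)).hasFDerivAt
  have hmetric : ∀ (V : ℝ → Plane) (τ : ℝ → ℝ) (w : Plane × ℝ),
      (fun u => stationaryMetricInChart X.metric η φ (φ (c u), T u) (V u, τ u) w) =ᶠ[𝓝 s]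
        fun u => inner ℝ (V u) w.1 - (covectorInChart η φ (φ (c u)) (V u) + τ u) *
          (covectorInChart η φ (φ (c u)) w.1 + w.2) := fun V τ w => by
    filter_upwards [hc.eventually_mem (φ.open_source.mem_nhds hs)] with u hu
    exact stationaryMetricInChart_eq hφ η (φ.map_source hu) _ _
  have hβw : ∀ (V : ℝ → Plane), HasDerivAt (fun u => φ (c u)) (V s) s → ∀ w : Plane × ℝ,
      HasDerivAt (fun u => covectorInChart η φ (φ (c u)) w.1 + w.2)
        (fderiv ℝ (covectorInChart η φ) (φ (c s)) (V s) w.1) s := fun V hV w =>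
    hasDerivAt_clm_comp_apply (γ := fun u => φ (c u)) hβ hV w.1 w.2
  have hsymm := (hη φ hφ.1).2 _ htgt
  constructor
  · rintro ⟨Z, hZ, hgeo⟩
    have hV : ∀ᶠ u in 𝓝 s, HasDerivAt (fun u => φ (c u)) (Z u).1 u :=
      hZ.mono fun u hu => (ContinuousLinearMap.fst ℝ Plane ℝ).hasFDerivAt.comp_hasDerivAt u hu
    have hτ : ∀ᶠ u in 𝓝 s, HasDerivAt T (Z u).2 u :=
      hZ.mono fun u hu => (ContinuousLinearMap.snd ℝ Plane ℝ).hasFDerivAt.comp_hasDerivAt u hu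
    have hgeo' : ∀ w : Plane × ℝ, HasDerivAt (fun u => inner ℝ (Z u).1 w.1 -
        (covectorInChart η φ (φ (c u)) (Z u).1 + (Z u).2) *
          (covectorInChart η φ (φ (c u)) w.1 + w.2))
        (-((covectorInChart η φ (φ (c s)) (Z s).1 + (Z s).2) *
          fderiv ℝ (covectorInChart η φ) (φ (c s)) w.1 (Z s).1)) s := fun w => by
      have h1 := (hgeo w).congr_of_eventuallyEq
        (hmetric (fun u => (Z u).1) (fun u => (Z u).2) w).symm
      refine h1.congr_deriv ?_
      rw [fderiv_stationaryMetricInChart hφ hη (z := (φ (c s), T s)) htgt]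
      ring
    -- The direction `(0, 1)` is the Killing field: the coefficients do not depend on `t`, so the
    -- momentum is conserved.
    have hP : HasDerivAt (fun u => covectorInChart η φ (φ (c u)) (Z u).1 + (Z u).2) 0 s := by
      have := (hgeo' (0, 1)).fun_neg
      simpa using this
    refine ⟨fun u => (Z u).1, fun u => (Z u).2, hV, hτ, ?_, hP⟩
    refine hasDerivAt_zero_of_inner fun w => ?_
    -- Adding the derivative of momentum times $\omega(w)$ isolates $\langle V,w\rangle$. The
    -- remaining force is the momentum times $d\omega(V,w)$, which is zero by closedness.
    have h1 := (hgeo' (w, 0)).fun_add (hP.fun_mul (hβw (fun u => (Z u).1) hV.self_of_nhds (w, 0)))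
    simp only [sub_add_cancel] at h1
    refine h1.congr_deriv ?_
    rw [hsymm]
    ring
  · rintro ⟨V, τ, hV, hτ, hV0, hP⟩
    refine ⟨fun u => (V u, τ u), ?_, fun w => ?_⟩
    · filter_upwards [hV, hτ] with u h1 h2 using h1.prodMk h2
    · refine HasDerivAt.congr_of_eventuallyEq ?_ (hmetric V τ w)
      have h1 := (hV0.inner ℝ (hasDerivAt_const s w.1)).fun_sub
        (hP.fun_mul (hβw V hV.self_of_nhds w))
      refine h1.congr_deriv ?_
      rw [fderiv_stationaryMetricInChart hφ hη (z := (φ (c s), T s)) htgt, hsymm]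
      simp
      ring

/-- The geodesics of the singular spacetime that are not contained in a singular line project to
geodesics of the surface, and their time coordinate solves a first order equation. -/
theorem isSpacetimeGeodesic_iff [T2Space S] (hη : X.IsClosedForm η) (hI : IsOpenInterval I) :
    X.IsSpacetimeGeodesic η f (fun s => (c s, T s)) I ↔
      (∃ q l : ℝ, (∀ s ∈ I, X.IsGeodesicAt q c s) ∧
        (∀ s ∈ I, c s ∉ X.sing → HasDerivAt T (l - η (c s) (velocity c s)) s) ∧
        ContinuousOn (fun s => T s + f (c s)) I) ∨
      ∃ p ∈ X.sing, ∃ a b : ℝ, ∀ s ∈ I, c s = p ∧ T s = a + b * s := by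
  constructor
  · rintro ⟨hc, hh, hg, ⟨q, E, hq⟩, hcross | ⟨p, hp, a, b, h⟩⟩
    · left
      have hcat : ∀ u ∈ I, ContinuousAt c u := fun u hu => hc.continuousAt (hI.1.mem_nhds hu)
      have hsol : ∀ u ∈ I, c u ∉ X.sing → X.IsFreeAt c u ∧ DifferentiableAt ℝ T u := by
        intro u hu hur
        obtain ⟨φ, hφ, huφ, hsol⟩ := hg u hu hur
        obtain ⟨V, τ, hV, hτ, hV0, -⟩ :=
          (solvesGeodesicEq_stationaryMetric_iff hη hφ (hcat u hu) huφ).1 hsol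
        exact ⟨⟨φ, hφ, huφ, V, hV, hV0⟩, hτ.self_of_nhds.differentiableAt⟩
      -- Here `-E` is the constant $\lambda$ and `q + E ^ 2` the squared speed of the projection.
      -- Since `q` and `E` are the same at all regular times, so are these two.
      have hE : ∀ u ∈ I, c u ∉ X.sing → η (c u) (velocity c u) + deriv T u = -E ∧
          X.metric (c u) (velocity c u) (velocity c u) = q + E ^ 2 := by
        intro u hu hur
        obtain ⟨h1, h2⟩ := hq u hu hur
        have h1' : X.metric (c u) (velocity c u) (velocity c u) -
          (η (c u) (velocity c u) + deriv T u) * (η (c u) (velocity c u) + deriv T u) = q := h1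
        have h2' : X.metric (c u) (velocity c u) 0 -
          (η (c u) (velocity c u) + deriv T u) * (η (c u) 0 + 1) = E := h2
        rw [map_zero, map_zero] at h2'
        have h3 : η (c u) (velocity c u) + deriv T u = -E := by linarith
        refine ⟨h3, ?_⟩
        rw [h3] at h1'
        linarith
      refine ⟨q + E ^ 2, -E, fun s hs => ⟨hcat s hs, fun hreg => ?_, hcross s hs⟩,
        fun s hs hreg => ?_, hh⟩
      · obtain ⟨q', hq'⟩ := isStraightAt_of_isFreeAt hI.1 hc (fun u hu hur => (hsol u hu hur).1)
          hs hreg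
        rwa [← (hE s hs hreg).2, hq'.metric_velocity (hcat s hs)]
      · refine (hsol s hs hreg).2.hasDerivAt.congr_deriv ?_
        linarith [(hE s hs hreg).1]
    · exact Or.inr ⟨p, hp, a, b, fun s hs => Prod.mk.inj (h s hs)⟩
  · rintro (⟨q, l, hc, hT, hh⟩ | ⟨p, hp, a, b, h⟩)
    · refine ⟨fun s hs => (hc s hs).continuousAt.continuousWithinAt, hh, fun s hs hreg => ?_,
        ⟨q - l ^ 2, -l, fun s hs hreg => ?_⟩, Or.inl fun s hs => (hc s hs).isolated⟩
      · obtain ⟨φ, hφ, hsφ, V, -, hev⟩ := (hc s hs).straight hreg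
        have hV := hasDerivAt_of_eventually_line hev
        have hform : ∀ᶠ u in 𝓝 s, η (c u) (velocity c u) = covectorInChart η φ (φ (c u)) V := by
          filter_upwards [hI.1.mem_nhds hs, hV,
            (hc s hs).continuousAt.eventually_mem (φ.open_source.mem_nhds hsφ)] with u h1 h2 h3
          exact covector_velocity hφ.1.mdifferentiable (hc u h1).continuousAt h3 h2 η
        refine ⟨φ, hφ, hsφ, (solvesGeodesicEq_stationaryMetric_iff hη hφ (hc s hs).continuousAt
          hsφ).2 ⟨fun _ => V, fun u => l - η (c u) (velocity c u), hV, ?_, hasDerivAt_const s V,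
          ?_⟩⟩
        · filter_upwards [hI.1.mem_nhds hs, (hc s hs).eventually_regular hreg] with u h1 h2
            using hT u h1 h2
        · refine (hasDerivAt_const s l).congr_of_eventuallyEq ?_
          filter_upwards [hform] with u hu
          rw [hu]; ring
      · have h1 := ((hc s hs).straight hreg).metric_velocity (hc s hs).continuousAt
        have h2 : deriv T s = l - η (c s) (velocity c s) := (hT s hs hreg).deriv
        constructor
        · change X.metric (c s) (velocity c s) (velocity c s) -
            (η (c s) (velocity c s) + deriv T s) * (η (c s) (velocity c s) + deriv T s) = _
          rw [h1, h2]; ring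
        · change X.metric (c s) (velocity c s) 0 -
            (η (c s) (velocity c s) + deriv T s) * (η (c s) 0 + 1) = _
          rw [map_zero, map_zero, h2]; ring
    · have hreg : ∀ s ∈ I, c s ∉ X.sing → False := fun s hs hn => hn (by rwa [(h s hs).1])
      refine ⟨continuousOn_const.congr fun s hs => (h s hs).1, ?_,
        fun s hs hn => (hreg s hs hn).elim, ⟨0, 0, fun s hs hn => (hreg s hs hn).elim⟩,
        Or.inr ⟨p, hp, a, b, fun s hs => Prod.ext (h s hs).1 (h s hs).2⟩⟩
      have : ContinuousOn (fun s => (a + b * s) + f p) I := by fun_prop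
      exact this.congr fun s hs => by simp only [height]; rw [(h s hs).1, (h s hs).2]

/-- The geodesics of the singular spacetime are the lifts of the geodesics of the surface. -/
theorem isSpacetimeGeodesic_iff_integral [T2Space S] (hη : X.IsClosedForm η) (hf : X.IsGauge η f)
    (hI : IsOpenInterval I) :
    X.IsSpacetimeGeodesic η f (fun s => (c s, T s)) I ↔
      X.IsSurfaceGeodesic c I ∧ ∃ l : ℝ,
        (∀ a ∈ I, ∀ s ∈ I,
          IntervalIntegrable (fun u => gaugedForm η f (c u) (velocity c u))
            MeasureTheory.volume a s ∧
          T s + f (c s) = T a + f (c a) + l * (s - a)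
            - ∫ u in a..s, gaugedForm η f (c u) (velocity c u)) ∧
        (∀ a ∈ I, ∀ s ∈ I, (∀ u ∈ uIcc a s, c u ∉ X.sing) →
          IntervalIntegrable (fun u => η (c u) (velocity c u)) MeasureTheory.volume a s ∧
          T s = T a + l * (s - a) - ∫ u in a..s, η (c u) (velocity c u)) := by
  rw [isSpacetimeGeodesic_iff hη hI, isSurfaceGeodesic_iff hI]
  constructor
  · rintro (⟨q, l, hc, hT, hh⟩ | ⟨p, hp, a, b, h⟩)
    · obtain ⟨k, -, -, hint⟩ := intervalIntegrable_gaugedForm hη hf hI hc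
      exact ⟨Or.inl ⟨q, hc⟩, l,
        fun a ha s hs => ⟨(hint a ha s hs).2.1, height_eq_of_hasDerivAt hη hf hI hc hT hh ha hs⟩,
        fun a ha s hs hreg => time_eq_of_hasDerivAt hη hI hc hT ha hs hreg⟩
    · refine ⟨Or.inr ⟨p, hp, fun s hs => (h s hs).1⟩, b, fun a' ha s hs => ?_,
        -- On a singular line the second formula is vacuous, since the path meets the singular set
        -- at once.
        fun a' ha s hs hreg => (hreg a' left_mem_uIcc (by rwa [(h a' ha).1])).elim⟩
      obtain ⟨h1, h2⟩ := integral_form_const hI (fun s hs => (h s hs).1) (gaugedForm η f) ha hs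
      refine ⟨h1, ?_⟩
      rw [h2, (h s hs).1, (h s hs).2, (h a' ha).1, (h a' ha).2]
      ring
  -- The formula with $\omega'$ alone characterises geodesics; the one with $\omega$ is a
  -- consequence.
  · rintro ⟨⟨q, hc⟩ | ⟨p, hp, h⟩, l, h1, -⟩
    · obtain ⟨hT, hh⟩ := hasDerivAt_of_height_eq hη hf hI hc fun a ha s hs => (h1 a ha s hs).2
      exact Or.inl ⟨q, l, hc, hT, hh⟩
    · obtain ⟨a, ha⟩ := hI.2.2
      refine Or.inr ⟨p, hp, T a - l * a, l, fun s hs => ⟨h s hs, ?_⟩⟩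
      have h2 := (h1 a ha s hs).2
      rw [(integral_form_const hI h (gaugedForm η f) ha hs).2, h s hs, h a ha] at h2
      linarith

/-- Every geodesic of the singular spacetime extends to the whole real line. -/
theorem exists_spacetime_extension [T2Space S] [CompactSpace S] (hη : X.IsClosedForm η)
    (hf : X.IsGauge η f) (hI : IsOpenInterval I) {γ : ℝ → S × ℝ}
    (hγ : X.IsSpacetimeGeodesic η f γ I) :
    ∃ γ' : ℝ → S × ℝ, X.IsSpacetimeGeodesic η f γ' univ ∧ EqOn γ' γ I := by
  have huniv : IsOpenInterval univ := ⟨isOpen_univ, ordConnected_univ, univ_nonempty⟩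
  rcases (isSpacetimeGeodesic_iff (c := fun s => (γ s).1) (T := fun s => (γ s).2) hη hI).1 hγ with
    ⟨q, l, hc, hT, hh⟩ | ⟨p, hp, a, b, h⟩
  · obtain ⟨d, hd, hdc⟩ := exists_extension hI hc
    obtain ⟨a, ha⟩ := hI.2.2
    have hdcn : ∀ s ∈ I, (fun s => (γ s).1) =ᶠ[𝓝 s] d := fun s hs =>
      Filter.eventually_of_mem (hI.1.mem_nhds hs) fun u hu => (hdc hu).symm
    obtain ⟨k, -, -, hint⟩ := intervalIntegrable_gaugedForm hη hf huniv fun u _ => hd u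
    have hint' := fun a s => (hint a (mem_univ a) s (mem_univ s)).2.1
    -- The time coordinate is dictated by the integral formula based at `a`, which additivity of the
    -- integral moves to any other base point.
    set τ : ℝ → ℝ := fun s => (γ a).2 + f (d a) + l * (s - a)
      - (∫ u in a..s, gaugedForm η f (d u) (velocity d u)) - f (d s) with hτ
    have hform : ∀ a' s, τ s + f (d s) = τ a' + f (d a') + l * (s - a')
        - ∫ u in a'..s, gaugedForm η f (d u) (velocity d u) := fun a' s => by
      have := intervalIntegral.integral_add_adjacent_intervals (hint' a a') (hint' a' s)
      simp only [hτ]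
      linarith
    obtain ⟨hT', hh'⟩ := hasDerivAt_of_height_eq hη hf huniv (fun u _ => hd u)
      fun a' _ s _ => hform a' s
    refine ⟨fun s => (d s, τ s), (isSpacetimeGeodesic_iff hη huniv).2
      (Or.inl ⟨q, l, fun u _ => hd u, hT', hh'⟩), fun s hs => Prod.ext (hdc hs) ?_⟩
    -- On `I` the original time coordinate satisfies the same formula along `d`, since `d` and the
    -- projection have equal velocities there; hence it equals `τ`.
    have h1 := height_eq_of_hasDerivAt (c := d) (T := fun s => (γ s).2) hη hf hI (fun u _ => hd u)
      (fun u hu hreg => by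
        have hreg' : (γ u).1 ∉ X.sing := by rwa [hdc hu] at hreg
        rw [← (hc u hu).covector_velocity_congr (hdcn u hu) hreg' η]
        exact hT u hu hreg')
      (hh.congr fun u hu => by simp only [hdc hu]) ha hs
    simp only [hτ]
    linarith
  · exact ⟨fun s => (p, a + b * s), (isSpacetimeGeodesic_iff hη huniv).2
      (Or.inr ⟨p, hp, a, b, fun s _ => ⟨rfl, rfl⟩⟩),
      fun s hs => Prod.ext (h s hs).1.symm (h s hs).2.symm⟩

end ConeSurface

theorem proposition4p5 {S : Type*} [TopologicalSpace S] [T2Space S] [CompactSpace S]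
    [ChartedSpace Plane S] [IsManifold 𝓘(ℝ, Plane) ∞ S]
    (X : ConeSurface S) (η : CovectorField S) (hη : X.IsClosedForm η)
    (f : S → ℝ) (hf : X.IsGauge η f) :
    -- inextensible geodesics are defined on the whole real line
    X.GeodesicallyComplete η f ∧
    -- every geodesic extends to a geodesic on the whole real line
    (∀ (I : Set ℝ) (γ : ℝ → S × ℝ), IsOpenInterval I → X.IsSpacetimeGeodesic η f γ I →
      ∃ γ' : ℝ → S × ℝ, X.IsSpacetimeGeodesic η f γ' univ ∧ EqOn γ' γ I) ∧
    -- the form of the geodesics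
    (∀ (I : Set ℝ) (c : ℝ → S) (T : ℝ → ℝ), IsOpenInterval I →
      (X.IsSpacetimeGeodesic η f (fun s => (c s, T s)) I ↔
        X.IsSurfaceGeodesic c I ∧ ∃ l : ℝ,
          (∀ a ∈ I, ∀ s ∈ I,
            IntervalIntegrable (fun u => gaugedForm η f (c u) (ConeSurface.velocity c u))
              MeasureTheory.volume a s ∧
            T s + f (c s) = T a + f (c a) + l * (s - a)
              - ∫ u in a..s, gaugedForm η f (c u) (ConeSurface.velocity c u)) ∧
          (∀ a ∈ I, ∀ s ∈ I, (∀ u ∈ uIcc a s, c u ∉ X.sing) →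
            IntervalIntegrable (fun u => η (c u) (ConeSurface.velocity c u))
              MeasureTheory.volume a s ∧
            T s = T a + l * (s - a) - ∫ u in a..s, η (c u) (ConeSurface.velocity c u)))) := by
  refine ⟨fun I γ hI hγ hmax => ?_, fun I γ hI hγ => ConeSurface.exists_spacetime_extension hη hf
    hI hγ, fun I c T hI => ConeSurface.isSpacetimeGeodesic_iff_integral hη hf hI⟩
  by_contra hne
  obtain ⟨γ', hγ', heq⟩ := ConeSurface.exists_spacetime_extension hη hf hI hγ
  exact hmax ⟨univ, γ', ⟨isOpen_univ, ordConnected_univ, univ_nonempty⟩,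
    ssubset_univ_iff.2 hne, hγ', heq⟩

end
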